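/- Work over $\mathbb{C}$. Coweights of $SL_N$ are written in coordinates (as diagonal matrices), $w_0$ reverses the coordinates, $\alpha_i$, $\varpi_i$ and $\varpi_i^\vee$ denote the simple coroots, fundamental coweights and fundamental weights, with the convention $\varpi_N=0$ for $SL_N$, and $t^\mu=\mathrm{diag}(t^{\mu_1},\dots,t^{\mu_N})$. For dominant coweights $\mu\le\lambda$ of $G=SL_N$, where $\mu$ has integer coordinates, let $G_1[[t^{-1}]]$ be the kernel of the evaluation $G[[t^{-1}]]\to G$ at $t=\infty$, let $$G_\mu=\{g\in G_1[[t^{-1}]] : t^{-w_0\mu}\,g\,t^{w_0\mu}\in G_1[[t^{-1}]]\},\qquad \mathcal W_\mu=G_\mu\, t^{w_0\mu}\subset G((t^{-1})),$$ and let ${}^{G}\mathcal X_\mu^\lambda$ be the closed subscheme of the affine scheme $\mathcal W_\mu$ (of infinite type) defined by the following conditions on $h\in\mathcal W_\mu$: for every dominant weight $\tau^\vee$ of $G$, every matrix coefficient of $h$ acting on $V(\tau^\vee)((t^{-1}))$ has valuation at least $\langle\lambda,w_0\tau^\vee\rangle$. Here $V(\tau^\vee)$ is the irreducible representation of highest weight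 $\tau^\vee$, and valuation $\ge d$ means that the coefficient of $t^e$ vanishes for all $e<d$. Let $n\ge2$, and let $\lambda=\sum_{i=1}^{n-1}m_i\,\alpha_{n-i}$ be a dominant coweight of $SL_n$ with integers $m_i\ge0$. Set $k=m_1$ and assume $k\ge1$ (equivalently $\lambda\ne0$). Let $\tau$ be the linear map from coweights of $SL_n$ to coweights of $SL_{kn}$ with $\tau(\varpi_i)=\varpi_i$ for $1\le i\le n-1$. Then there is an isomorphism of schemes over $\mathbb{C}$ $${}^{SL_n}\mathcal X_0^\lambda\ \xrightarrow{\ \sim\ }\ {}^{SL_{kn}}\mathcal X_{k\varpi_n}^{\tau(\lambda)}$$ given on points by $$g\longmapsto\begin{pmatrix}t^{-1}I&0\\0&t^{k-1}g\end{pmatrix},$$ where the upper left block has size $kn-n$ and the lower right block has size $n$. -/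

import Mathlib

/-! Slices in the affine Grassmannian of `SL_N` over `ℂ`, as affine schemes.

Series: `R((t⁻¹))` is `LaurentSeries R`, whose variable is `t⁻¹`; so `f.coeff s` is the
coefficient of `t ^ (-s)` in `f`.

Coweights of `SL_N` are vectors in `ℚ ^ N` with coordinate sum `0` and integral differences
(diagonal matrices in `sl_N`); a coweight is a cocharacter of the diagonal torus when its
entries are integers. All indices start at `0`: the element `i` of `Fin (N - 1)` stands for
the node `i + 1` of the Dynkin diagram `A_{N-1}`. -/

noncomputable section

namespace AffineSlice

/-! ### Coweights -/

/-- The first of the two rows that belong to a node of the Dynkin diagram `A_{N-1}`. -/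
def rowA {N : ℕ} (i : Fin (N - 1)) : Fin N := ⟨i.1, by have := i.2; omega⟩

/-- The second of the two rows that belong to a node of the Dynkin diagram `A_{N-1}`. -/
def rowB {N : ℕ} (i : Fin (N - 1)) : Fin N := ⟨i.1 + 1, by have := i.2; omega⟩

/-- The simple coroot `α_{i+1} = e_{i+1} - e_{i+2}` of `SL_N`. -/
def simpleCoroot (N : ℕ) (i : Fin (N - 1)) : Fin N → ℚ :=
  Pi.single (rowA i) 1 - Pi.single (rowB i) 1

/-- The pairing `⟨lam, α_{i+1}^∨⟩` of a coweight with a simple root. -/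
def rootPairing {N : ℕ} (lam : Fin N → ℚ) (i : Fin (N - 1)) : ℚ :=
  lam (rowA i) - lam (rowB i)

/-- A coweight is dominant if it pairs non-negatively with all simple roots. -/
def IsDominant {N : ℕ} (lam : Fin N → ℚ) : Prop := ∀ i, 0 ≤ rootPairing lam i

/-- The fundamental coweight `ϖ_i` of `SL_N` (here `i` is the honest index, `1 ≤ i ≤ N - 1`):
`(1, …, 1, 0, …, 0) - (i / N) (1, …, 1)` with `i` ones. For `i = N` this is `0`. -/
def fundCoweight (N i : ℕ) : Fin N → ℚ := fun j => (if j.1 < i then 1 else 0) - (i : ℚ) / N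

/-- For `n, k ≥ 1` the coweight `k ϖ_n` of `SL_{kn}` is a cocharacter, namely
`(k - 1, …, k - 1, -1, …, -1)` with `n` entries `k - 1`. -/
theorem smul_fundCoweight {n k : ℕ} (hn : 0 < n) (hk : 0 < k) (j : Fin (k * n)) :
    ((k : ℚ) • fundCoweight (k * n) n) j = ((if j.1 < n then (k : ℤ) - 1 else -1 : ℤ) : ℚ) := by
  have hn' : (n : ℚ) ≠ 0 := by positivity
  have hk' : (k : ℚ) ≠ 0 := by positivity
  simp only [Pi.smul_apply, fundCoweight, smul_eq_mul]
  split_ifs <;> push_cast <;> field_simp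
  simp

/-- The action of the longest Weyl group element `w₀` on coweights: reversal of coordinates. -/
def longest {N : ℕ} (lam : Fin N → ℚ) : Fin N → ℚ := fun j => lam j.rev

/-- The pairing of a coweight `lam` with the weight `∑ i, a i • ϖ_{i+1}^∨`, where
`ϖ_{i+1}^∨` is the sum of the first `i + 1` coordinates. -/
def weightPairing {N : ℕ} (lam : Fin N → ℚ) (a : Fin (N - 1) → ℕ) : ℚ :=
  ∑ i, (a i : ℚ) * ∑ j : Fin N, if j.1 < i.1 + 1 then lam j else 0

/-- The map from coweights of `SL_n` to coweights of `SL_N` (for `n ≤ N`) that is linear and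
sends `ϖ_i` to `ϖ_i`: the coefficient of `ϖ_i` in `lam` is its pairing with `α_i^∨`. -/
def tau {n : ℕ} (N : ℕ) (lam : Fin n → ℚ) : Fin N → ℚ :=
  ∑ i : Fin (n - 1), rootPairing lam i • fundCoweight N (i.1 + 1)

/-! ### Irreducible representations of `SL_N` -/

/-- Indices for the standard basis of `Λ^i` of the standard representation. -/
abbrev Subsets (N i : ℕ) : Type := {S : Finset (Fin N) // S.card = i}

/-- The minor of `g` with rows `C` and columns `D`: a matrix entry of `Λ^i g`. -/
def minor {N i : ℕ} {L : Type} [CommRing L] (g : Matrix (Fin N) (Fin N) L)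
    (C D : Subsets N i) : L :=
  (g.submatrix (C.1.orderEmbOfFin C.2) (D.1.orderEmbOfFin D.2)).det

/-- The tensor factors of `⨂_i (Λ^{i+1}) ^ {⊗ a i}`. -/
abbrev Slots (N : ℕ) (a : Fin (N - 1) → ℕ) : Type := Σ i : Fin (N - 1), Fin (a i)

/-- Indices for the standard basis of `⨂_i (Λ^{i+1}) ^ {⊗ a i}`. -/
abbrev TensorIdx (N : ℕ) (a : Fin (N - 1) → ℕ) : Type :=
  (p : Slots N a) → Subsets N (p.1.1 + 1)

/-- The matrix of `g` acting on `⨂_i (Λ^{i+1}) ^ {⊗ a i}`, in the standard basis. -/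
def tensorAction {N : ℕ} (a : Fin (N - 1) → ℕ) {L : Type} [CommRing L]
    (g : Matrix (Fin N) (Fin N) L) : Matrix (TensorIdx N a) (TensorIdx N a) L :=
  Matrix.of fun C D => ∏ p, minor g (C p) (D p)

/-- The subset of the first `i + 1` indices: the highest weight vector of `Λ^{i+1}`. -/
def firstSubset {N : ℕ} (i : Fin (N - 1)) : Subsets N (i.1 + 1) :=
  ⟨(Finset.univ : Finset (Fin (i.1 + 1))).map
      (Fin.castLEEmb (by have := i.2; omega)), by simp⟩

/-- The index of the highest weight vector `⨂_i (e_1 ∧ ⋯ ∧ e_{i+1}) ^ {⊗ a i}`. -/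
def highestIdx (N : ℕ) (a : Fin (N - 1) → ℕ) : TensorIdx N a := fun p => firstSubset p.1

/-- The irreducible representation `V(τ^∨)` of `SL_N` over `ℂ` with highest weight
`τ^∨ = ∑ i, a i • ϖ_{i+1}^∨`, realised as the subrepresentation of
`⨂_i (Λ^{i+1}) ^ {⊗ a i}` that is generated by the highest weight vector. -/
def irrep (N : ℕ) (a : Fin (N - 1) → ℕ) : Submodule ℂ (TensorIdx N a → ℂ) :=
  Submodule.span ℂ (Set.range fun g : Matrix.SpecialLinearGroup (Fin N) ℂ =>
    (tensorAction a g.1).mulVec (Pi.single (highestIdx N a) 1))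

/-- The matrix coefficient `β (g v)` where `β` is the coordinate function with index `C`.
The coordinate functions span the dual of `irrep N a`. -/
def matrixCoeff {N : ℕ} {a : Fin (N - 1) → ℕ} {R : Type} [CommRing R] [Algebra ℂ R]
    (C : TensorIdx N a) (v : TensorIdx N a → ℂ)
    (g : Matrix (Fin N) (Fin N) (LaurentSeries R)) : LaurentSeries R :=
  ∑ D, v D • tensorAction a g C D

/-! ### The slices -/

/-- `t ^ a` in `R((t⁻¹))`. -/
def tpow (R : Type) [CommRing R] (a : ℤ) : LaurentSeries R := HahnSeries.single (-a) 1

/-- The diagonal matrix `t ^ mu`, for a cocharacter `mu`; its entries are integers, so the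
floor only turns a rational number that is an integer into that integer. -/
def tCoweight {N : ℕ} (R : Type) [CommRing R] (mu : Fin N → ℚ) :
    Matrix (Fin N) (Fin N) (LaurentSeries R) :=
  Matrix.diagonal fun i => tpow R ⌊mu i⌋

/-- The elements of `R` that have to vanish in order that a matrix
`g ∈ 1 + t⁻¹ Mat_N(R[[t⁻¹]])` is such that `h = g t^{w₀ mu}` is a point of the slice:
* the coefficients of `det g - 1` (so that `g` lies in `G_1[[t⁻¹]]`, with `G = SL_N`);
* the coefficients of `t ^ e`, for all `e ≥ 0`, of the entries of
  `t^{-w₀ mu} g t^{w₀ mu} - 1` (so that this conjugate lies in `G_1[[t⁻¹]]` as well, and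
  `h` lies in `W_mu`);
* for each dominant weight `τ^∨ = ∑ i, a i • ϖ_{i+1}^∨`, the coefficients of `t ^ e`, for all
  `e < ⟨lam, w₀ τ^∨⟩ = ⟨w₀ lam, τ^∨⟩`, of the matrix coefficients of `h` on `V(τ^∨)` (so that
  the valuation of `h` on `V(τ^∨)((t⁻¹))`, the lowest exponent of `t`, is
  at least `⟨lam, w₀ τ^∨⟩`). -/
def relations {N : ℕ} (mu lam : Fin N → ℚ) {R : Type} [CommRing R] [Algebra ℂ R]
    (g : Matrix (Fin N) (Fin N) (LaurentSeries R)) : Set R :=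
  {r | ∃ s : ℤ, r = (g.det - 1).coeff s} ∪
  {r | ∃ (i j : Fin N) (e : ℤ), 0 ≤ e ∧
    r = ((tCoweight R (-longest mu) * g * tCoweight R (longest mu) - 1) i j).coeff (-e)} ∪
  {r | ∃ (a : Fin (N - 1) → ℕ), ∃ v ∈ irrep N a, ∃ (C : TensorIdx N a) (e : ℤ),
    (e : ℚ) < weightPairing (longest lam) a ∧
    r = (matrixCoeff C v (g * tCoweight R (longest mu))).coeff (-e)}

/-- The coordinate ring of the space of all matrices in `1 + t⁻¹ Mat_N(R[[t⁻¹]])`; the variable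
`(i, j, s)` is the coefficient of `t ^ (-(s + 1))` of the entry `(i, j)`. -/
abbrev Ambient (N : ℕ) : Type := MvPolynomial (Fin N × Fin N × ℕ) ℂ

/-- The universal matrix in `1 + t⁻¹ Mat_N(R[[t⁻¹]])`. -/
def universal (N : ℕ) : Matrix (Fin N) (Fin N) (LaurentSeries (Ambient N)) :=
  Matrix.of fun i j => HahnSeries.ofPowerSeries ℤ (Ambient N) (PowerSeries.mk fun s =>
    Nat.casesOn s (if i = j then 1 else 0) fun s' => MvPolynomial.X (i, j, s'))

/-- The ideal of the slice. -/
def sliceIdeal {N : ℕ} (mu lam : Fin N → ℚ) : Ideal (Ambient N) :=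
  Ideal.span (relations mu lam (universal N))

/-- The coordinate ring of the slice. -/
abbrev SliceRing {N : ℕ} (mu lam : Fin N → ℚ) : Type := Ambient N ⧸ sliceIdeal mu lam

open CategoryTheory AlgebraicGeometry

/-- The slice `X_mu^lam` of `SL_N`, a scheme over `ℂ`. -/
def slice {N : ℕ} (mu lam : Fin N → ℚ) : Over (Spec (CommRingCat.of ℂ)) :=
  Over.mk (Spec.map (CommRingCat.ofHom (algebraMap ℂ (SliceRing mu lam))))

/-- The matrix `h = g t^{w₀ mu}` with entries in `R((t⁻¹))` that corresponds to an `R`-point of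
the slice. -/
def pointMatrix {N : ℕ} {mu lam : Fin N → ℚ} {R : Type} [CommRing R]
    (p : Spec (CommRingCat.of R) ⟶ (slice mu lam).left) :
    Matrix (Fin N) (Fin N) (LaurentSeries R) :=
  let q : Spec (CommRingCat.of R) ⟶ Spec (CommRingCat.of (SliceRing mu lam)) := p
  let φ : Ambient N →+* R :=
    (Spec.preimage q).hom.comp (Ideal.Quotient.mk (sliceIdeal mu lam))
  (universal N * tCoweight (Ambient N) (longest mu)).map fun f => f.map φ

/-- The block diagonal matrix of size `N` with diagonal blocks `t⁻¹ I` (of size `N - n`) and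
`t^{k-1} g` (of size `n`). -/
def blockMatrix {n N : ℕ} (h : n ≤ N) (k : ℕ) {R : Type} [CommRing R]
    (g : Matrix (Fin n) (Fin n) (LaurentSeries R)) :
    Matrix (Fin N) (Fin N) (LaurentSeries R) :=
  Matrix.reindex (finSumFinEquiv.trans (finCongr (Nat.sub_add_cancel h)))
    (finSumFinEquiv.trans (finCongr (Nat.sub_add_cancel h)))
    (Matrix.fromBlocks (tpow R (-1) • (1 : Matrix (Fin (N - n)) (Fin (N - n)) (LaurentSeries R)))
      0 0 (tpow R ((k : ℤ) - 1) • g))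

end AffineSlice

end

/-! Both families of valuation conditions are conditions on minors. The representation `V(τ^∨)` lies
in a tensor product of exterior powers, so its matrix coefficients are combinations of products of
minors; conversely every minor is a coefficient of a fundamental representation. For dominant `λ`
the condition therefore says that each `i × i` minor of `h` has valuation at least the sum of the
`i` smallest coordinates of `λ` (`relations_subset_zero_iff`).

Since `λ_n = -k`, one finds `τ(λ) = (λ_1 + k - 1, …, λ_n + k - 1, -1, …, -1)`, whose smallest
coordinate is `-1` (`tau_apply`). So for a point `M t^{w₀ μ}` of the large slice, `μ = k ϖ_n`, all
entries have valuation at least `-1`. The first `kn - n` columns carry the factor `t⁻¹`, and `M ∈ 1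
+ t⁻¹ Mat`, so there `M` agrees with the identity. In the upper right block the bound leaves only
exponents `≥ -k` in `M`, while the conjugation condition allows only exponents `< -k`, so the block
vanishes. Hence `M = diag(1, g)` (`eq_blockOne`).

It remains to compare minors of `diag(1, g) t^{w₀ μ}` with those of `g`. One direction uses `λ_j + k
≥ 0` (`minorBound_blockOne`); the other enlarges a minor of `g` by the whole first block
(`minorBound_of_blockOne`). All this holds over an arbitrary `ℂ`-algebra, so it applies to the
universal points of both slices and yields mutually inverse maps of coordinate rings
(`exists_algEquiv_of_slicePoint`). -/

noncomputable section

namespace AffineSlice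

/-! ### Valuations of Laurent series -/

/-- All powers of `t` that occur in `f ∈ R((t⁻¹))` have exponent at least `b`. -/
def ValGE {R : Type} [CommRing R] (b : ℚ) (f : LaurentSeries R) : Prop :=
  ∀ e : ℤ, (e : ℚ) < b → f.coeff (-e) = 0

section ValGE

variable {R : Type} [CommRing R]

theorem ValGE.mono {b c : ℚ} {f : LaurentSeries R} (hf : ValGE b f) (h : c ≤ b) : ValGE c f :=
  fun e he => hf e (he.trans_le h)

theorem ValGE.zero (b : ℚ) : ValGE b (0 : LaurentSeries R) := fun _ _ => HahnSeries.coeff_zero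

theorem ValGE.add {b : ℚ} {f g : LaurentSeries R} (hf : ValGE b f) (hg : ValGE b g) :
    ValGE b (f + g) := fun e he => by
  rw [HahnSeries.coeff_add, hf e he, hg e he, add_zero]

theorem ValGE.neg {b : ℚ} {f : LaurentSeries R} (hf : ValGE b f) : ValGE b (-f) := fun e he => by
  rw [HahnSeries.coeff_neg, hf e he, neg_zero]

theorem ValGE.smul [Algebra ℂ R] {b : ℚ} {f : LaurentSeries R} (c : ℂ) (hf : ValGE b f) :
    ValGE b (c • f) := fun e he => by
  rw [HahnSeries.coeff_smul, hf e he, smul_zero]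

theorem ValGE.sum {ι : Type*} {b : ℚ} {f : ι → LaurentSeries R} (s : Finset ι)
    (hf : ∀ i ∈ s, ValGE b (f i)) : ValGE b (∑ i ∈ s, f i) :=
  Finset.sum_induction f (ValGE b) (fun _ _ => ValGE.add) (ValGE.zero b) hf

theorem ValGE.tpow (a : ℤ) : ValGE (a : ℚ) (tpow R a) := fun e he =>
  HahnSeries.coeff_single_of_ne fun h => by
    have : e < a := by exact_mod_cast he
    omega

theorem tpow_zero : tpow R 0 = 1 := rfl

theorem tpow_mul_tpow (a b : ℤ) : tpow R a * tpow R b = tpow R (a + b) := by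
  rw [tpow, tpow, HahnSeries.single_mul_single, tpow, mul_one, neg_add]

theorem tpow_pow (a : ℤ) (j : ℕ) : tpow R a ^ j = tpow R (j * a) := by
  rw [tpow, HahnSeries.single_pow, one_pow, tpow, nsmul_eq_mul, mul_neg]

theorem coeff_mul_tpow (f : LaurentSeries R) (a s : ℤ) :
    (f * tpow R a).coeff s = f.coeff (s + a) := by
  have := HahnSeries.coeff_mul_single_add (x := f) (r := (1 : R)) (a := s + a) (b := -a)
  simpa [tpow] using this

theorem ValGE.one : ValGE 0 (1 : LaurentSeries R) := by
  simpa [tpow_zero] using ValGE.tpow (R := R) 0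

theorem ValGE.mul {b c : ℚ} {f g : LaurentSeries R} (hf : ValGE b f) (hg : ValGE c g) :
    ValGE (b + c) (f * g) := fun e he => by
  rw [HahnSeries.coeff_mul]
  refine Finset.sum_eq_zero fun ij hij => ?_
  rw [Finset.mem_antidiagonal] at hij
  obtain ⟨-, -, hij⟩ := hij
  have he' : (ij.1 : ℚ) + ij.2 = -e := by exact_mod_cast hij
  -- Two exponents of `t` with sum below `b + c` cannot both respect their bounds.
  rcases lt_or_ge (-(ij.1 : ℚ)) b with h | h
  · rw [← neg_neg ij.1, hf (-ij.1) (by push_cast; exact h), zero_mul]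
  · rw [← neg_neg ij.2, hg (-ij.2) (by push_cast; linarith), mul_zero]

theorem ValGE.prod {ι : Type*} {b : ι → ℚ} {f : ι → LaurentSeries R} (s : Finset ι)
    (hf : ∀ i ∈ s, ValGE (b i) (f i)) : ValGE (∑ i ∈ s, b i) (∏ i ∈ s, f i) := by
  classical
  induction s using Finset.induction_on with
  | empty => simpa using ValGE.one
  | insert i s hi ih =>
    rw [Finset.sum_insert hi, Finset.prod_insert hi]
    exact (hf i (Finset.mem_insert_self i s)).mul
      (ih fun j hj => hf j (Finset.mem_insert_of_mem hj))

theorem ValGE.mul_of_zero {b : ℚ} {f g : LaurentSeries R} (hf : ValGE 0 f) (hg : ValGE b g) :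
    ValGE b (f * g) := by
  simpa using hf.mul hg

theorem ValGE.sign_mul {b : ℚ} {f : LaurentSeries R} (u : ℤˣ) (hf : ValGE b f) :
    ValGE b (((u : ℤ) : LaurentSeries R) * f) := by
  rcases Int.units_eq_one_or u with rfl | rfl
  · simpa using hf
  · simpa using hf.neg

end ValGE

/-! ### Change of coefficients -/

/-- The ring homomorphism `A((t⁻¹)) → B((t⁻¹))` induced by a ring homomorphism `A → B`. -/
def seriesMap {A B : Type} [CommRing A] [CommRing B] (φ : A →+* B) :
    LaurentSeries A →+* LaurentSeries B where
  toFun f := f.map φ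
  map_one' := HahnSeries.map_one φ.toMonoidWithZeroHom
  map_mul' _ _ := HahnSeries.map_mul φ.toNonUnitalRingHom
  map_zero' := by ext; simp
  map_add' _ _ := HahnSeries.map_add φ.toAddMonoidHom

section seriesMap

variable {A B : Type} [CommRing A] [CommRing B]

@[simp] theorem seriesMap_coeff (φ : A →+* B) (f : LaurentSeries A) (s : ℤ) :
    (seriesMap φ f).coeff s = φ (f.coeff s) := rfl

@[simp] theorem seriesMap_tpow (φ : A →+* B) (a : ℤ) : seriesMap φ (tpow A a) = tpow B a := by
  ext s
  rw [seriesMap_coeff, tpow, tpow, HahnSeries.coeff_single, HahnSeries.coeff_single]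
  split_ifs <;> simp

theorem seriesMap_smul [Algebra ℂ A] [Algebra ℂ B] (φ : A →ₐ[ℂ] B) (c : ℂ) (f : LaurentSeries A) :
    seriesMap (φ : A →+* B) (c • f) = c • seriesMap (φ : A →+* B) f := by
  ext s
  simp

/-- The entrywise action of `seriesMap` on square matrices. -/
abbrev matMap {N : Type} [Fintype N] [DecidableEq N] (φ : A →+* B) :
    Matrix N N (LaurentSeries A) →+* Matrix N N (LaurentSeries B) :=
  (seriesMap φ).mapMatrix

theorem matMap_tCoweight (φ : A →+* B) {N : ℕ} (mu : Fin N → ℚ) :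
    matMap φ (tCoweight A mu) = tCoweight B mu := by
  simp [matMap, tCoweight, Matrix.diagonal_map]

theorem matMap_minor (φ : A →+* B) {N i : ℕ} (g : Matrix (Fin N) (Fin N) (LaurentSeries A))
    (C D : Subsets N i) : minor (matMap φ g) C D = seriesMap φ (minor g C D) := by
  rw [minor, minor, RingHom.map_det]
  rfl

theorem matMap_matrixCoeff [Algebra ℂ A] [Algebra ℂ B] (φ : A →ₐ[ℂ] B) {N : ℕ}
    {a : Fin (N - 1) → ℕ} (g : Matrix (Fin N) (Fin N) (LaurentSeries A))
    (C : TensorIdx N a) (v : TensorIdx N a → ℂ) :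
    matrixCoeff C v (matMap (φ : A →+* B) g) =
      seriesMap (φ : A →+* B) (matrixCoeff C v g) := by
  simp only [matrixCoeff, map_sum, seriesMap_smul, tensorAction, Matrix.of_apply, map_prod,
    matMap_minor]

/-- Every relation is a coefficient of an expression in `g` built from ring operations, complex
scalars and powers of `t`, all preserved by a `ℂ`-algebra map. Hence the ideal of the slice dies
under evaluation at `g` exactly when `g` satisfies the relations. -/
theorem relations_matMap [Algebra ℂ A] [Algebra ℂ B] (φ : A →ₐ[ℂ] B) {N : ℕ}
    (mu lam : Fin N → ℚ) (g : Matrix (Fin N) (Fin N) (LaurentSeries A)) :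
    relations mu lam (matMap (φ : A →+* B) g) = φ '' relations mu lam g := by
  have hdet : ∀ s, ((matMap (φ : A →+* B) g).det - 1).coeff s = φ ((g.det - 1).coeff s) := by
    intro s
    have := seriesMap_coeff (φ : A →+* B) (g.det - 1) s
    rw [map_sub, map_one, RingHom.map_det] at this
    exact this
  have hconj : ∀ i j s, ((tCoweight B (-longest mu) * matMap (φ : A →+* B) g *
      tCoweight B (longest mu) - 1) i j).coeff s =
      φ (((tCoweight A (-longest mu) * g * tCoweight A (longest mu) - 1) i j).coeff s) := by
    intro i j s
    rw [← matMap_tCoweight (φ : A →+* B), ← matMap_tCoweight (φ : A →+* B), ← map_mul, ← map_mul,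
      ← map_one (matMap (φ : A →+* B)), ← map_sub]
    rfl
  have hcoeff : ∀ (a : Fin (N - 1) → ℕ) (v) (C : TensorIdx N a) (s),
      (matrixCoeff C v (matMap (φ : A →+* B) g * tCoweight B (longest mu))).coeff s =
      φ ((matrixCoeff C v (g * tCoweight A (longest mu))).coeff s) := by
    intro a v C s
    rw [← matMap_tCoweight (φ : A →+* B), ← map_mul, matMap_matrixCoeff]
    rfl
  ext r
  simp only [relations, Set.mem_union, Set.mem_ofPred_eq, Set.mem_image, hdet, hconj, hcoeff]
  constructor
  · rintro ((⟨s, rfl⟩ | ⟨i, j, e, he, rfl⟩) | ⟨a, v, hv, C, e, he, rfl⟩)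
    · exact ⟨_, Or.inl (Or.inl ⟨s, rfl⟩), rfl⟩
    · exact ⟨_, Or.inl (Or.inr ⟨i, j, e, he, rfl⟩), rfl⟩
    · exact ⟨_, Or.inr ⟨a, v, hv, C, e, he, rfl⟩, rfl⟩
  · rintro ⟨r, (⟨s, rfl⟩ | ⟨i, j, e, he, rfl⟩) | ⟨a, v, hv, C, e, he, rfl⟩, rfl⟩
    · exact Or.inl (Or.inl ⟨s, rfl⟩)
    · exact Or.inl (Or.inr ⟨i, j, e, he, rfl⟩)
    · exact Or.inr ⟨a, v, hv, C, e, he, rfl⟩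

end seriesMap

/-! ### The universal property of the slices -/

/-- The matrix `g` lies in `1 + t⁻¹ Mat_N(R[[t⁻¹]])`. -/
def IsOneAdd {N : Type} [DecidableEq N] {R : Type} [CommRing R]
    (g : Matrix N N (LaurentSeries R)) : Prop :=
  ∀ i j, ∀ s : ℤ, s ≤ 0 → ((g - 1) i j).coeff s = 0

theorem universal_coeff_succ (N : ℕ) (i j : Fin N) (s : ℕ) :
    (universal N i j).coeff ((s + 1 : ℕ) : ℤ) = MvPolynomial.X (i, j, s) := by
  rw [universal, Matrix.of_apply, HahnSeries.ofPowerSeries_apply_coeff, PowerSeries.coeff_mk]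

theorem isOneAdd_universal (N : ℕ) : IsOneAdd (universal N) := by
  intro i j s hs
  rw [Matrix.sub_apply, HahnSeries.coeff_sub, sub_eq_zero]
  rcases hs.lt_or_eq with hs | rfl
  · rw [universal, Matrix.of_apply, HahnSeries.ofPowerSeries_apply,
      HahnSeries.embDomain_of_notMem_range, Matrix.one_apply]
    · split_ifs
      · rw [HahnSeries.coeff_one, if_neg hs.ne]
      · rw [HahnSeries.coeff_zero]
    · rintro ⟨x, rfl⟩
      simp at hs
      omega
  · have := HahnSeries.ofPowerSeries_apply_coeff (Γ := ℤ) (PowerSeries.mk fun s =>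
      Nat.casesOn (motive := fun _ => Ambient N) s (if i = j then 1 else 0)
        fun s' => MvPolynomial.X (i, j, s')) 0
    rw [universal, Matrix.of_apply]
    refine this.trans ?_
    rw [PowerSeries.coeff_mk, Matrix.one_apply]
    split_ifs <;> simp

theorem IsOneAdd.matMap {N : Type} [Fintype N] [DecidableEq N] {A B : Type} [CommRing A]
    [CommRing B] (φ : A →+* B) {g : Matrix N N (LaurentSeries A)} (hg : IsOneAdd g) :
    IsOneAdd (matMap φ g) := by
  intro i j s hs
  rw [← map_one (AffineSlice.matMap φ), ← map_sub]
  exact (congrArg φ (hg i j s hs)).trans (map_zero φ)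

theorem IsOneAdd.ext {N : Type} [DecidableEq N] {R : Type} [CommRing R]
    {g h : Matrix N N (LaurentSeries R)} (hg : IsOneAdd g) (hh : IsOneAdd h)
    (H : ∀ i j (s : ℕ), (g i j).coeff ((s + 1 : ℕ) : ℤ) = (h i j).coeff ((s + 1 : ℕ) : ℤ)) :
    g = h := by
  ext i j s
  rcases le_or_gt s 0 with hs | hs
  · have h1 := hg i j s hs
    have h2 := hh i j s hs
    rw [Matrix.sub_apply, HahnSeries.coeff_sub, sub_eq_zero] at h1 h2
    rw [h1, h2]
  · obtain ⟨s', rfl⟩ : ∃ s' : ℕ, s = ((s' + 1 : ℕ) : ℤ) := ⟨(s - 1).toNat, by omega⟩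
    exact H i j s'

section universalProperty

variable {N : ℕ} {mu lam : Fin N → ℚ} {R : Type} [CommRing R] [Algebra ℂ R]

/-- The homomorphism of coordinate rings that corresponds to a point of the ambient space. -/
def evalAmbient (g : Matrix (Fin N) (Fin N) (LaurentSeries R)) : Ambient N →ₐ[ℂ] R :=
  MvPolynomial.aeval fun x => (g x.1 x.2.1).coeff ((x.2.2 + 1 : ℕ) : ℤ)

theorem matMap_evalAmbient {g : Matrix (Fin N) (Fin N) (LaurentSeries R)} (hg : IsOneAdd g) :
    matMap (evalAmbient g : Ambient N →+* R) (universal N) = g := by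
  refine ((isOneAdd_universal N).matMap _).ext hg fun i j s => ?_
  refine (congrArg (evalAmbient g) (universal_coeff_succ N i j s)).trans ?_
  rw [evalAmbient, MvPolynomial.aeval_X]

variable (mu lam) in
/-- The universal point of the slice. -/
def slicePoint : Matrix (Fin N) (Fin N) (LaurentSeries (SliceRing mu lam)) :=
  matMap (Ideal.Quotient.mk (sliceIdeal mu lam)) (universal N)

variable (mu lam) in
theorem isOneAdd_slicePoint : IsOneAdd (slicePoint mu lam) := (isOneAdd_universal N).matMap _

variable (mu lam) in
theorem relations_slicePoint : relations mu lam (slicePoint mu lam) ⊆ {0} := by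
  have := relations_matMap (Ideal.Quotient.mkₐ ℂ (sliceIdeal mu lam)) mu lam (universal N)
  refine this.le.trans ?_
  rintro _ ⟨r, hr, rfl⟩
  exact Ideal.Quotient.eq_zero_iff_mem.mpr (Ideal.subset_span hr)

/-- The homomorphism of coordinate rings that corresponds to a point of the slice. -/
def evalSlice (g : Matrix (Fin N) (Fin N) (LaurentSeries R)) (hg : IsOneAdd g)
    (hrel : relations mu lam g ⊆ {0}) : SliceRing mu lam →ₐ[ℂ] R :=
  Ideal.Quotient.liftₐ (sliceIdeal mu lam) (evalAmbient g) <| by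
    have : sliceIdeal mu lam ≤ RingHom.ker (evalAmbient g) := by
      have h := relations_matMap (evalAmbient g) mu lam (universal N)
      rw [matMap_evalAmbient hg] at h
      exact Ideal.span_le.mpr fun r hr => hrel (h ▸ ⟨r, hr, rfl⟩)
    exact fun a ha => this ha

theorem matMap_evalSlice (g : Matrix (Fin N) (Fin N) (LaurentSeries R)) (hg : IsOneAdd g)
    (hrel : relations mu lam g ⊆ {0}) :
    matMap (evalSlice g hg hrel : SliceRing mu lam →+* R) (slicePoint mu lam) = g := by
  have : (evalSlice g hg hrel : SliceRing mu lam →+* R).comp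
      (Ideal.Quotient.mk (sliceIdeal mu lam)) = (evalAmbient g : Ambient N →+* R) := by
    ext x <;> rfl
  conv_rhs => rw [← matMap_evalAmbient hg, ← this]
  rfl

/-- The coefficients of the universal matrix generate the coordinate ring. With `evalSlice`, this
says that the ring represents the functor of matrices satisfying the relations. -/
theorem sliceRing_hom_ext {φ ψ : SliceRing mu lam →ₐ[ℂ] R}
    (h : matMap (φ : SliceRing mu lam →+* R) (slicePoint mu lam) =
      matMap (ψ : SliceRing mu lam →+* R) (slicePoint mu lam)) : φ = ψ := by
  refine Ideal.Quotient.algHom_ext _ (MvPolynomial.algHom_ext fun x => ?_)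
  obtain ⟨i, j, s⟩ := x
  have := congrArg (fun M => (M i j).coeff ((s + 1 : ℕ) : ℤ)) h
  rw [← universal_coeff_succ N i j s]
  exact this

end universalProperty

/-! ### Partial sums of coweights -/

/-- The sum of the first `i` coordinates: the pairing of `lam` with `ϖ_i^∨`. -/
def psum {N : ℕ} (lam : Fin N → ℚ) (i : ℕ) : ℚ := ∑ j : Fin N, if j.1 < i then lam j else 0

theorem psum_zero {N : ℕ} (lam : Fin N → ℚ) : psum lam 0 = 0 := by simp [psum]

theorem psum_add {N : ℕ} (a b : Fin N → ℚ) (i : ℕ) : psum (a + b) i = psum a i + psum b i := by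
  simp only [psum, ← Finset.sum_add_distrib]
  refine Finset.sum_congr rfl fun j _ => ?_
  split_ifs <;> simp

theorem psum_const {N : ℕ} (c : ℚ) {i : ℕ} (hi : i ≤ N) : psum (fun _ : Fin N => c) i = i * c := by
  have h : (Finset.univ.filter fun j : Fin N => j.1 < i).card = i := by
    rw [Fin.card_filter_val_lt, min_eq_right hi]
  rw [psum, ← Finset.sum_filter, Finset.sum_const, h, nsmul_eq_mul]

theorem psum_mono {N : ℕ} {lam : Fin N → ℚ} (h : ∀ j, 0 ≤ lam j) : Monotone (psum lam) := by
  intro a b hab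
  refine Finset.sum_le_sum fun j _ => ?_
  split_ifs with h1 h2
  · exact le_rfl
  · omega
  · exact h j
  · exact le_rfl

theorem psum_self {N : ℕ} (lam : Fin N → ℚ) : psum lam N = ∑ j, lam j :=
  Finset.sum_congr rfl fun j _ => if_pos j.2

theorem weightPairing_eq {N : ℕ} (lam : Fin N → ℚ) (a : Fin (N - 1) → ℕ) :
    weightPairing lam a = ∑ p : Slots N a, psum lam (p.1.1 + 1) := by
  rw [Fintype.sum_sigma]
  exact Finset.sum_congr rfl fun i _ => by simp [psum]

/-! ### Exterior powers as irreducible representations -/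

theorem exists_perm_firstSubset {N : ℕ} (i : Fin (N - 1)) (D : Subsets N (i.1 + 1)) :
    ∃ σ : Equiv.Perm (Fin N), ∀ p : Fin (i.1 + 1),
      σ ((firstSubset i).1.orderEmbOfFin (firstSubset i).2 p) = D.1.orderEmbOfFin D.2 p := by
  classical
  let f := (firstSubset i).1.orderIsoOfFin (firstSubset i).2
  let g := D.1.orderIsoOfFin D.2
  let e : {x // x ∈ (firstSubset i).1} ≃ {x // x ∈ D.1} := f.toEquiv.symm.trans g.toEquiv
  refine ⟨e.extendSubtype, fun p => ?_⟩
  have := e.extendSubtype_apply_of_mem (f p).1 (f p).2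
  refine this.trans ?_
  simp [e, g]

/-- Every coordinate vector of `Λ^{i+1}` is, up to sign, in the orbit of the highest weight
vector under `SL_N(ℂ)`. -/
theorem exists_minor_eq_single {N : ℕ} (i : Fin (N - 1)) (D : Subsets N (i.1 + 1)) :
    ∃ g : Matrix.SpecialLinearGroup (Fin N) ℂ, ∃ c : ℂ, c ≠ 0 ∧
      ∀ C : Subsets N (i.1 + 1), minor g.1 C (firstSubset i) = if C = D then c else 0 := by
  classical
  obtain ⟨σ, hσ⟩ := exists_perm_firstSubset i D
  -- A permutation matrix for `σ` moves the first `i + 1` indices onto `D`; rescaling one column,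
  -- here `x`, by the sign of `σ` makes the determinant `1`.
  let x : Fin N := rowA i
  let d : Fin N → ℂ := fun q => if q = x then ((Equiv.Perm.sign σ : ℤ) : ℂ) else 1
  have hs : (((Equiv.Perm.sign σ : ℤ) : ℂ)) * ((Equiv.Perm.sign σ : ℤ) : ℂ) = 1 := by
    rcases Int.units_eq_one_or (Equiv.Perm.sign σ) with h | h <;> simp [h]
  have hd0 : ∀ q, d q ≠ 0 := by
    intro q
    simp only [d]
    split_ifs
    · exact left_ne_zero_of_mul_eq_one hs
    · exact one_ne_zero
  let g : Matrix (Fin N) (Fin N) ℂ := Matrix.of fun p q => d q * (if p = σ q then 1 else 0)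
  have hg : g.det = 1 := by
    have h1 := Matrix.det_mul_row d (Matrix.of fun p q : Fin N => if p = σ q then (1 : ℂ) else 0)
    have h2 : (Matrix.of fun p q : Fin N => if p = σ q then (1 : ℂ) else 0) =
        (1 : Matrix (Fin N) (Fin N) ℂ).submatrix id σ := by
      ext p q
      simp [Matrix.one_apply]
    have h3 : ∏ q, d q = ((Equiv.Perm.sign σ : ℤ) : ℂ) := by
      simp [d, Finset.prod_ite_eq']
    rw [h2, Matrix.det_permute', Matrix.det_one, mul_one, h3, hs, ← h2] at h1
    exact h1
  refine ⟨⟨g, hg⟩, ∏ p, d ((firstSubset i).1.orderEmbOfFin (firstSubset i).2 p),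
    Finset.prod_ne_zero_iff.mpr fun p _ => hd0 _, fun C => ?_⟩
  split_ifs with hCD
  · subst hCD
    have : g.submatrix (C.1.orderEmbOfFin C.2)
        ((firstSubset i).1.orderEmbOfFin (firstSubset i).2) =
        Matrix.diagonal fun p => d ((firstSubset i).1.orderEmbOfFin (firstSubset i).2 p) := by
      ext p q
      simp only [Matrix.submatrix_apply, g, Matrix.of_apply, hσ, Matrix.diagonal_apply,
        EmbeddingLike.apply_eq_iff_eq]
      split_ifs with h
      · rw [h, mul_one]
      · rw [mul_zero]
    exact (congrArg Matrix.det this).trans Matrix.det_diagonal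
  -- If `C ≠ D` have equal size, some row of `C` lies outside `D`; the chosen columns have their
  -- nonzero entries only in the rows of `D`.
  · obtain ⟨y, hy, hyD⟩ : ∃ y ∈ C.1, y ∉ D.1 := by
      by_contra! hcon
      exact hCD (Subtype.ext (Finset.eq_of_subset_of_card_le hcon (by rw [C.2, D.2])))
    obtain ⟨p, rfl⟩ : ∃ p, C.1.orderEmbOfFin C.2 p = y := by
      have : y ∈ Set.range (C.1.orderEmbOfFin C.2) := by
        rw [Finset.range_orderEmbOfFin]
        exact hy
      exact this
    refine Matrix.det_eq_zero_of_row_eq_zero p fun q => ?_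
    simp only [Matrix.submatrix_apply, g, Matrix.of_apply, hσ]
    rw [if_neg, mul_zero]
    rintro h
    exact hyD (h ▸ Finset.orderEmbOfFin_mem _ _ _)

/-- All minors are matrix coefficients of fundamental representations. -/
theorem exists_matrixCoeff_eq_minor {N : ℕ} (i : Fin (N - 1)) (C D : Subsets N (i.1 + 1)) :
    ∃ v ∈ irrep N (Pi.single i 1), ∃ C' : TensorIdx N (Pi.single i 1),
      ∀ {R : Type} [CommRing R] [Algebra ℂ R] (h : Matrix (Fin N) (Fin N) (LaurentSeries R)),
        matrixCoeff C' v h = minor h C D := by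
  classical
  let a : Fin (N - 1) → ℕ := Pi.single i 1
  let p₀ : Slots N a := ⟨i, ⟨0, by simp [a]⟩⟩
  have hp : ∀ p : Slots N a, p = p₀ := by
    rintro ⟨j, s⟩
    have hj : j = i := by
      by_contra hne
      have := s.2
      simp [a, hne] at this
    subst hj
    have : s = ⟨0, by simp [a]⟩ := by
      have h1 : a j = 1 := by simp [a]
      have := s.2
      ext
      simp only
      omega
    rw [this]
  -- A fundamental weight gives a single tensor factor, so the action is by minors.
  let : Unique (Slots N a) := ⟨⟨p₀⟩, hp⟩
  have hact : ∀ {L : Type} [CommRing L] (g : Matrix (Fin N) (Fin N) L) (X Y : TensorIdx N a),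
      tensorAction a g X Y = minor g (X p₀) (Y p₀) := by
    intro L _ g X Y
    exact Fintype.prod_unique _
  let idx : Subsets N (i.1 + 1) → TensorIdx N a := fun S =>
    Function.update (highestIdx N a) p₀ S
  have hidx : ∀ S, idx S p₀ = S := fun S => Function.update_self _ _ _
  have hext : ∀ X Y : TensorIdx N a, X p₀ = Y p₀ → X = Y := by
    intro X Y h
    funext p
    obtain rfl := hp p
    exact h
  obtain ⟨g, c, hc, hg⟩ := exists_minor_eq_single i D
  refine ⟨Pi.single (idx D) 1, ?_, idx C, ?_⟩
  · have hmem : (tensorAction a g.1).mulVec (Pi.single (highestIdx N a) 1) ∈ irrep N a :=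
      Submodule.subset_span ⟨g, rfl⟩
    have : (tensorAction a g.1).mulVec (Pi.single (highestIdx N a) 1) =
        c • Pi.single (idx D) 1 := by
      ext X
      rw [Matrix.mulVec_single_one, Matrix.col_apply, hact]
      refine (hg (X p₀)).trans ?_
      simp only [Pi.smul_apply, Pi.single_apply, smul_eq_mul, mul_ite, mul_one, mul_zero]
      refine if_congr ⟨fun h => hext _ _ (by rw [h, hidx]), fun h => by rw [h, hidx]⟩ rfl rfl
    rw [this] at hmem
    exact (Submodule.smul_mem_iff _ hc).mp hmem
  · intro R _ _ h
    rw [matrixCoeff, Finset.sum_eq_single (idx D)]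
    · rw [Pi.single_eq_same, one_smul]
      change tensorAction a h _ _ = _
      rw [hact, hidx, hidx]
    · intro Y _ hY
      rw [Pi.single_eq_of_ne hY, zero_smul]
    · simp

/-! ### The equations of the slices in terms of minors -/

/-- The minor of size `i` of `h`, for all choices of rows and columns, has valuation at
least `b i`. -/
def MinorBound {κ R : Type} [CommRing R] (h : Matrix κ κ (LaurentSeries R)) (b : ℕ → ℚ) : Prop :=
  ∀ (i : ℕ) (f g : Fin i → κ), Function.Injective f → Function.Injective g →
    ValGE (b i) (h.submatrix f g).det

theorem exists_perm_orderEmb {N i : ℕ} (f : Fin i → Fin N) (hf : Function.Injective f) :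
    ∃ (C : Subsets N i) (σ : Equiv.Perm (Fin i)), f = C.1.orderEmbOfFin C.2 ∘ σ := by
  classical
  let C : Subsets N i := ⟨Finset.univ.image f, by
    rw [Finset.card_image_of_injective _ hf, Finset.card_univ, Fintype.card_fin]⟩
  have hC : ∀ p, f p ∈ C.1 := fun p => Finset.mem_image_of_mem f (Finset.mem_univ p)
  let s : Fin i → Fin i := fun p => (C.1.orderIsoOfFin C.2).symm ⟨f p, hC p⟩
  have hs : Function.Injective s := fun p q h =>
    hf (congrArg Subtype.val ((C.1.orderIsoOfFin C.2).symm.injective h))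
  refine ⟨C, Equiv.ofBijective s (Finite.injective_iff_bijective.mp hs), funext fun p => ?_⟩
  simp only [Function.comp_apply, Equiv.ofBijective_apply, s]
  rw [← Finset.coe_orderIsoOfFin_apply, OrderIso.apply_symm_apply]

theorem det_submatrix_perm {κ L : Type} [CommRing L] {i : ℕ} (h : Matrix κ κ L)
    (f g : Fin i → κ) (σ ρ : Equiv.Perm (Fin i)) :
    (h.submatrix (f ∘ σ) (g ∘ ρ)).det =
      ((Equiv.Perm.sign ρ : ℤ) : L) * (((Equiv.Perm.sign σ : ℤ) : L) *
        (h.submatrix f g).det) := by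
  rw [← Matrix.det_permute, ← Matrix.det_permute']
  rfl

theorem ValGE.det_submatrix_perm {κ R : Type} [CommRing R] {i : ℕ} {b : ℚ}
    {h : Matrix κ κ (LaurentSeries R)} {f g : Fin i → κ} (H : ValGE b (h.submatrix f g).det)
    (σ ρ : Equiv.Perm (Fin i)) : ValGE b (h.submatrix (f ∘ σ) (g ∘ ρ)).det := by
  rw [AffineSlice.det_submatrix_perm]
  exact (H.sign_mul _).sign_mul _

/-- Passing from increasing enumerations to arbitrary injections costs only signs. The sizes `0` and
`N` belong to no fundamental weight, so they need the separate assumptions `h0` and `hN`. -/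
theorem minorBound_of_minor {N : ℕ} {R : Type} [CommRing R]
    {h : Matrix (Fin N) (Fin N) (LaurentSeries R)} {b : ℕ → ℚ} (h0 : b 0 ≤ 0)
    (hN : ValGE (b N) h.det)
    (H : ∀ (i : Fin (N - 1)) (C D : Subsets N (i.1 + 1)), ValGE (b (i.1 + 1)) (minor h C D)) :
    MinorBound h b := by
  intro i f g hf hg
  have hi : i ≤ N := by simpa using Fintype.card_le_of_injective f hf
  rcases hi.lt_or_eq with hi | rfl
  · obtain ⟨C, σ, rfl⟩ := exists_perm_orderEmb f hf
    obtain ⟨D, ρ, rfl⟩ := exists_perm_orderEmb g hg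
    refine ValGE.det_submatrix_perm ?_ σ ρ
    rcases i with _ | i
    · rw [Matrix.det_fin_zero]
      exact ValGE.one.mono h0
    · exact H ⟨i, by omega⟩ C D
  · have := ValGE.det_submatrix_perm (h := h) (f := id) (g := id) (b := b i)
      (by rwa [Matrix.submatrix_id_id])
      (Equiv.ofBijective f (Finite.injective_iff_bijective.mp hf))
      (Equiv.ofBijective g (Finite.injective_iff_bijective.mp hg))
    exact this

theorem MinorBound.comp {κ κ' R : Type} [CommRing R] {h : Matrix κ κ (LaurentSeries R)}
    {b : ℕ → ℚ} (H : MinorBound h b) (e : κ' ↪ κ) : MinorBound (h.submatrix e e) b :=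
  fun i f g hf hg => H i (e ∘ f) (e ∘ g) (e.injective.comp hf) (e.injective.comp hg)

theorem MinorBound.minor {N : ℕ} {R : Type} [CommRing R]
    {h : Matrix (Fin N) (Fin N) (LaurentSeries R)} {b : ℕ → ℚ} (H : MinorBound h b) {i : ℕ}
    (C D : Subsets N i) : ValGE (b i) (minor h C D) :=
  H i _ _ (C.1.orderEmbOfFin C.2).injective (D.1.orderEmbOfFin D.2).injective

theorem det_tCoweight {N : ℕ} (R : Type) [CommRing R] (mu : Fin N → ℚ) :
    (tCoweight R mu).det = tpow R (∑ j, ⌊mu j⌋) := by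
  rw [tCoweight, Matrix.det_diagonal]
  induction (Finset.univ : Finset (Fin N)) using Finset.induction_on with
  | empty => simp [tpow_zero]
  | insert i s hi ih => rw [Finset.prod_insert hi, Finset.sum_insert hi, ih, tpow_mul_tpow]

/-- The equations of the slice. -/
theorem relations_subset_zero_iff {N : ℕ} {mu lam : Fin N → ℚ} {R : Type} [CommRing R]
    [Algebra ℂ R] {g : Matrix (Fin N) (Fin N) (LaurentSeries R)} (hmu : ∑ j, ⌊longest mu j⌋ = 0)
    (hlam : ∑ j, longest lam j = 0) :
    relations mu lam g ⊆ {0} ↔ g.det = 1 ∧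
      (∀ (i j : Fin N) (e : ℤ), 0 ≤ e →
        ((tCoweight R (-longest mu) * g * tCoweight R (longest mu) - 1) i j).coeff (-e) = 0) ∧
      MinorBound (g * tCoweight R (longest mu)) (psum (longest lam)) := by
  constructor
  · intro H
    have hdet : g.det = 1 := by
      rw [← sub_eq_zero]
      ext s
      exact H (Or.inl (Or.inl ⟨s, rfl⟩))
    refine ⟨hdet, fun i j e he => H (Or.inl (Or.inr ⟨i, j, e, he, rfl⟩)),
      minorBound_of_minor (psum_zero _).le ?_ fun i C D => ?_⟩
    -- In size `N` the bound is `0` and the minor is `1`, up to sign, because both coweights have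
    -- coordinate sum `0`.
    · rw [Matrix.det_mul, hdet, det_tCoweight, hmu, psum_self, hlam, tpow_zero, one_mul]
      exact ValGE.one
    · obtain ⟨v, hv, C', hC'⟩ := exists_matrixCoeff_eq_minor i C D
      intro e he
      rw [← hC']
      refine H (Or.inr ⟨_, v, hv, C', e, he.trans_eq ?_, rfl⟩)
      rw [weightPairing, Finset.sum_eq_single i]
      · simp [psum]
      · intro j _ hj
        simp [hj]
      · simp
  · rintro ⟨hdet, hconj, H⟩ r ((⟨s, rfl⟩ | ⟨i, j, e, he, rfl⟩) | ⟨a, v, hv, C, e, he, rfl⟩)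
    · rw [hdet, sub_self]
      exact HahnSeries.coeff_zero
    · exact hconj i j e he
    -- A matrix coefficient is a combination of products of minors, one for each tensor factor; the
    -- bounds of the factors add up to the pairing with `τ^∨`.
    · refine (ValGE.sum _ fun D _ => ValGE.smul (v D) ?_ :
        ValGE (weightPairing (longest lam) a) (matrixCoeff C v _)) e he
      rw [weightPairing_eq]
      exact ValGE.prod _ fun p _ => H.minor (C p) (D p)

/-! ### The coweights of the two slices -/

/-- The decomposition of the indices of a matrix of size `N` into two blocks. -/
def blockEquiv {n N : ℕ} (h : n ≤ N) : Fin (N - n) ⊕ Fin n ≃ Fin N :=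
  finSumFinEquiv.trans (finCongr (Nat.sub_add_cancel h))

theorem blockEquiv_inl {n N : ℕ} (h : n ≤ N) (a : Fin (N - n)) :
    (blockEquiv h (Sum.inl a)).1 = a.1 := by
  simp [blockEquiv]

theorem blockEquiv_inr {n N : ℕ} (h : n ≤ N) (b : Fin n) :
    (blockEquiv h (Sum.inr b)).1 = N - n + b.1 := by
  simp [blockEquiv]

/-- Telescoping over `j ≤ i < m`. With the Abel summation in `sum_sub_mul_succ` this evaluates the
two parts of `∑ ⟨λ, α_i^∨⟩ ϖ_i`. -/
theorem sum_sub_mul_indicator (L : ℕ → ℚ) (m j : ℕ) :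
    ∑ i ∈ Finset.range m, (L i - L (i + 1)) * (if j < i + 1 then 1 else 0) =
      if j < m then L j - L m else 0 := by
  induction m with
  | zero => simp
  | succ m ih =>
    rw [Finset.sum_range_succ, ih]
    rcases lt_trichotomy j m with h | rfl | h
    · rw [if_pos h, if_pos (by omega), if_pos (by omega)]
      ring
    · rw [if_neg (lt_irrefl _), if_pos (by omega), if_pos (by omega)]
      ring
    · rw [if_neg (by omega), if_neg (by omega), if_neg (by omega)]
      ring

theorem sum_sub_mul_succ (L : ℕ → ℚ) (m : ℕ) :
    ∑ i ∈ Finset.range m, (L i - L (i + 1)) * ((i + 1 : ℕ) : ℚ) =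
      ∑ i ∈ Finset.range (m + 1), L i - (m + 1) * L m := by
  induction m with
  | zero => simp
  | succ m ih =>
    rw [Finset.sum_range_succ, ih, Finset.sum_range_succ _ (m + 1)]
    push_cast
    ring

/-- The indicator parts of the fundamental coweights telescope to `λ_j - λ_n = λ_j + k`. The
constants `i / (kn)` contribute `(∑ λ_j - n λ_n) / (kn) = 1`, which is subtracted. -/
theorem tau_apply {n k : ℕ} (hn : 0 < n) (hk : 0 < k) {lam : Fin n → ℚ}
    (hlast : lam ⟨n - 1, by omega⟩ = -k) (hsum : ∑ j, lam j = 0) (j : Fin (k * n)) :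
    tau (k * n) lam j = (if h : j.1 < n then lam ⟨j.1, h⟩ + k else 0) - 1 := by
  obtain ⟨m, rfl⟩ : ∃ m, n = m + 1 := ⟨n - 1, by omega⟩
  -- Extending by zero to `ℕ` allows summation over ranges.
  let L : ℕ → ℚ := fun i => if h : i < m + 1 then lam ⟨i, h⟩ else 0
  have hL : ∀ i : Fin (m + 1), lam i = L i.1 := fun i => by simp only [L]; rw [dif_pos i.2]
  have hLm : L m = -k := (dif_pos (Nat.lt_succ_self m)).trans hlast
  have hk' : (k : ℚ) ≠ 0 := by positivity
  have hm' : ((m + 1 : ℕ) : ℚ) ≠ 0 := by positivity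
  have h1 : tau (k * (m + 1)) lam j = ∑ i ∈ Finset.range m, ((L i - L (i + 1)) *
      (if j.1 < i + 1 then 1 else 0) -
      (L i - L (i + 1)) * ((i + 1 : ℕ) : ℚ) / ((k * (m + 1) : ℕ) : ℚ)) := by
    rw [tau, Finset.sum_apply, ← Fin.sum_univ_eq_sum_range (fun i => (L i - L (i + 1)) *
      (if j.1 < i + 1 then 1 else 0) -
      (L i - L (i + 1)) * ((i + 1 : ℕ) : ℚ) / ((k * (m + 1) : ℕ) : ℚ)) m]
    refine Finset.sum_congr rfl fun i _ => ?_
    simp only [Pi.smul_apply, rootPairing, fundCoweight, hL, rowA, rowB, smul_eq_mul]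
    ring
  have h2 : ∑ i ∈ Finset.range (m + 1), L i = 0 := by
    rw [← Fin.sum_univ_eq_sum_range, ← hsum]
    exact Finset.sum_congr rfl fun i _ => (hL i).symm
  rw [h1, Finset.sum_sub_distrib, ← Finset.sum_div, sum_sub_mul_indicator, sum_sub_mul_succ, h2,
    hLm]
  congr 1
  · by_cases h : j.1 < m
    · rw [if_pos h, dif_pos (by omega), hL]
      ring
    · rw [if_neg h]
      split_ifs with h'
      · have : j.1 = m := by omega
        rw [hL]
        simp only [this, hLm]
        ring
      · rfl
  · push_cast at hm' ⊢
    field_simp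
    ring

theorem longest_tau {n k : ℕ} (hn : 0 < n) (hk : 0 < k) {lam : Fin n → ℚ}
    (hlast : lam ⟨n - 1, by omega⟩ = -k) (hsum : ∑ j, lam j = 0) (h : n ≤ k * n)
    (x : Fin (k * n - n) ⊕ Fin n) :
    longest (tau (k * n) lam) (blockEquiv h x) =
      Sum.elim (fun _ => 0) (fun b => k + longest lam b) x - 1 := by
  rw [longest, tau_apply hn hk hlast hsum]
  rcases x with a | b
  · rw [dif_neg]
    · rfl
    · rw [Fin.val_rev, blockEquiv_inl]
      omega
  · have hb : ((blockEquiv h (Sum.inr b)).rev : ℕ) = (b.rev : ℕ) := by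
      rw [Fin.val_rev, blockEquiv_inr, Fin.val_rev]
      omega
    rw [dif_pos (hb ▸ b.rev.2)]
    simp only [hb, Sum.elim_inr, longest]
    ring

theorem longest_smul_fundCoweight {n k : ℕ} (hn : 0 < n) (hk : 0 < k) (h : n ≤ k * n)
    (x : Fin (k * n - n) ⊕ Fin n) :
    longest ((k : ℚ) • fundCoweight (k * n) n) (blockEquiv h x) =
      ((Sum.elim (fun _ => -1) (fun _ => k - 1) x : ℤ) : ℚ) := by
  rw [longest, smul_fundCoweight hn hk]
  congr 1
  rcases x with a | b
  · rw [if_neg]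
    · rfl
    · rw [Fin.val_rev, blockEquiv_inl]
      omega
  · rw [if_pos]
    · rfl
    · rw [Fin.val_rev, blockEquiv_inr]
      omega

/-- Reversal puts the `kn - n` coordinates `-1` first. The subtraction `i - (kn - n)` is truncated,
so the sum is `-i` until the second block is reached. -/
theorem psum_longest_tau {n k : ℕ} (hn : 0 < n) (hk : 0 < k) {lam : Fin n → ℚ}
    (hlast : lam ⟨n - 1, by omega⟩ = -k) (hsum : ∑ j, lam j = 0) (h : n ≤ k * n) {i : ℕ}
    (hi : i ≤ k * n) :
    psum (longest (tau (k * n) lam)) i =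
      psum (fun b => k + longest lam b) (i - (k * n - n)) - i := by
  have h1 : longest (tau (k * n) lam) = (fun j => Sum.elim (fun _ => 0)
      (fun b => k + longest lam b) ((blockEquiv h).symm j)) + fun _ => -1 := by
    funext j
    obtain ⟨x, rfl⟩ := (blockEquiv h).surjective j
    rw [longest_tau hn hk hlast hsum, Pi.add_apply, Equiv.symm_apply_apply]
    ring
  rw [h1, psum_add, psum_const _ hi, psum, ← (blockEquiv h).sum_comp, Fintype.sum_sum_type, psum]
  simp only [Equiv.symm_apply_apply, Sum.elim_inl, Sum.elim_inr, ite_self, Finset.sum_const_zero,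
    zero_add, blockEquiv_inr]
  rw [mul_neg_one, ← sub_eq_add_neg]
  congr 1
  exact Finset.sum_congr rfl fun b _ => if_congr (by omega) rfl rfl

/-- Used with `c = k`, where the shifted coordinates are nonnegative and their partial sums
monotone. -/
theorem psum_longest {n : ℕ} (c : ℚ) (lam : Fin n → ℚ) {i : ℕ} (hi : i ≤ n) :
    psum (longest lam) i = psum (fun b => c + longest lam b) i - i * c := by
  have : (fun b => c + longest lam b) = (fun _ => c) + longest lam := rfl
  rw [this, psum_add, psum_const _ hi]
  ring

theorem sum_longest {n : ℕ} (lam : Fin n → ℚ) : ∑ j, longest lam j = ∑ j, lam j :=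
  Equiv.sum_comp Fin.revPerm lam

theorem last_le_of_isDominant {n : ℕ} (hn : 0 < n) {lam : Fin n → ℚ} (hdom : IsDominant lam)
    (j : Fin n) : lam ⟨n - 1, by omega⟩ ≤ lam j := by
  obtain ⟨m, rfl⟩ : ∃ m, n = m + 1 := ⟨n - 1, by omega⟩
  have : Antitone lam := Fin.antitone_iff_succ_le.mpr fun i => by
    have := hdom i
    rw [rootPairing, sub_nonneg] at this
    exact this
  exact this (Fin.le_last j)

/-! ### Minors of block matrices -/

section blocks

variable {P Q : Type}

/-- The number of indices in the second block. -/
def rightCount {i : ℕ} (f : Fin i → P ⊕ Q) : ℕ := ∑ p, if (f p).isRight then 1 else 0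

/-- Induction on the size. Expansion along a column of the first block has coefficients `0` or `±1`
and leaves minors with the same number of second-block columns. If no such column is left, a row of
the first block makes the minor vanish, and otherwise it is a minor of `g`. -/
theorem valGE_minor_fromBlocks_one [DecidableEq P] {R : Type} [CommRing R]
    {g : Matrix Q Q (LaurentSeries R)} {b : ℕ → ℚ}
    (hg : MinorBound g b) (i : ℕ) (f f' : Fin i → P ⊕ Q) (hf : Function.Injective f)
    (hf' : Function.Injective f') :
    ValGE (b (rightCount f'))
      ((Matrix.fromBlocks (1 : Matrix P P (LaurentSeries R)) 0 0 g).submatrix f f').det := by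
  induction i with
  | zero =>
    have := hg 0 Fin.elim0 Fin.elim0 (fun x => x.elim0) (fun x => x.elim0)
    rw [Matrix.det_fin_zero] at this ⊢
    simpa [rightCount] using this
  | succ i ih =>
    by_cases hleft : ∃ p a, f' p = Sum.inl a
    · obtain ⟨p, a, hp⟩ := hleft
      rw [Matrix.det_succ_column _ p]
      refine ValGE.sum _ fun q _ => ValGE.mul_of_zero ?_ ?_
      · have h1 : ValGE 0 ((-1 : LaurentSeries R) ^ (q + p : ℕ)) := by
          rcases neg_one_pow_eq_or (LaurentSeries R) (q + p : ℕ) with h | h <;> rw [h]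
          exacts [ValGE.one, ValGE.one.neg]
        refine ValGE.mul_of_zero h1 ?_
        rw [Matrix.submatrix_apply, hp]
        rcases f q with a' | b'
        · rw [Matrix.fromBlocks_apply₁₁, Matrix.one_apply]
          split_ifs
          exacts [ValGE.one, ValGE.zero _]
        · exact ValGE.zero _
      · have := ih (f ∘ q.succAbove) (f' ∘ p.succAbove)
          (hf.comp Fin.succAbove_right_injective) (hf'.comp Fin.succAbove_right_injective)
        have hcount : rightCount f' = rightCount (f' ∘ p.succAbove) := by
          rw [rightCount, Fin.sum_univ_succAbove _ p, hp]
          simp [rightCount]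
        rw [hcount]
        exact this
    · push Not at hleft
      have hR : ∀ p, ∃ b', f' p = Sum.inr b' := fun p => by
        rcases hx : f' p with a | b'
        · exact absurd hx (hleft p a)
        · exact ⟨b', rfl⟩
      choose d hd using hR
      obtain rfl : f' = Sum.inr ∘ d := funext hd
      have hcount : rightCount (Sum.inr ∘ d : Fin (i + 1) → P ⊕ Q) = i + 1 := by
        simp [rightCount]
      by_cases hrow : ∃ q a, f q = Sum.inl a
      · obtain ⟨q, a, hq⟩ := hrow
        rw [Matrix.det_eq_zero_of_row_eq_zero q]
        · exact ValGE.zero _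
        · intro p
          rw [Matrix.submatrix_apply, hq]
          rfl
      · push Not at hrow
        have hR : ∀ p, ∃ b', f p = Sum.inr b' := fun p => by
          rcases hx : f p with a | b'
          · exact absurd hx (hrow p a)
          · exact ⟨b', rfl⟩
        choose c hc using hR
        obtain rfl : f = Sum.inr ∘ c := funext hc
        rw [hcount]
        exact hg (i + 1) c d hf.of_comp hf'.of_comp

theorem rightCount_le [Fintype Q] {i : ℕ} {f : Fin i → P ⊕ Q} (hf : Function.Injective f) :
    rightCount f ≤ Fintype.card Q := by
  have : rightCount f = Fintype.card {p // (f p).isRight} := by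
    rw [rightCount, Fintype.card_subtype, Finset.card_filter]
  rw [this]
  refine Fintype.card_le_of_injective (fun p => (f p.1).getRight p.2) fun p q h => ?_
  exact Subtype.ext (hf (((Sum.inr_getRight (f p.1) p.2).symm.trans (congrArg Sum.inr h)).trans
    (Sum.inr_getRight (f q.1) q.2)))

/-- At most `|P|` of the chosen indices lie in the first block. This lower bound on the number of
second-block columns is what the monotonicity argument in `minorBound_blockOne` needs. -/
theorem le_rightCount_add [Fintype P] {i : ℕ} {f : Fin i → P ⊕ Q} (hf : Function.Injective f) :
    i ≤ rightCount f + Fintype.card P := by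
  have h1 : rightCount f = Fintype.card {p // (f p).isRight} := by
    rw [rightCount, Fintype.card_subtype, Finset.card_filter]
  have h2 : Fintype.card {p // ¬ (f p).isRight} ≤ Fintype.card P := by
    have hl : ∀ p : {p // ¬ (f p).isRight}, (f p.1).isLeft := fun p => by simpa using p.2
    refine Fintype.card_le_of_injective (fun p => (f p.1).getLeft (hl p)) fun p q h => ?_
    exact Subtype.ext (hf (((Sum.inl_getLeft (f p.1) (hl p)).symm.trans
      (congrArg Sum.inl h)).trans (Sum.inl_getLeft (f q.1) (hl q))))
  have h3 := Fintype.card_subtype_compl fun p => ((f p).isRight : Prop)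
  have h4 := Fintype.card_subtype_le fun p => ((f p).isRight : Prop)
  rw [Fintype.card_fin] at h3 h4
  omega

end blocks

/-! ### Points of the two slices -/

/-- The exponents of `t ^ (w₀ (k ϖ_n))`. -/
def blockExp (P Q : Type) (k : ℕ) : P ⊕ Q → ℤ := Sum.elim (fun _ => -1) fun _ => k - 1

theorem sum_blockExp {P Q : Type} (k : ℕ) {i : ℕ} (f : Fin i → P ⊕ Q) :
    ∑ p, blockExp P Q k (f p) = k * rightCount f - i := by
  have h : ∀ x, blockExp P Q k x = k * (if x.isRight then 1 else 0) - 1 := by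
    rintro (a | b) <;> simp [blockExp]
  simp only [h, Finset.sum_sub_distrib, ← Finset.mul_sum, rightCount]
  simp

theorem blockExp_congr (P Q : Type) (k : ℕ) (x y : P ⊕ Q) (h : x.isLeft = y.isLeft) :
    blockExp P Q k x = blockExp P Q k y := by
  rcases x with a | b <;> rcases y with c | d <;> simp_all [blockExp]

/-- The block diagonal matrix with blocks `1` and `g`. -/
def blockOne {n N : ℕ} (h : n ≤ N) {R : Type} [CommRing R]
    (g : Matrix (Fin n) (Fin n) (LaurentSeries R)) :
    Matrix (Fin N) (Fin N) (LaurentSeries R) :=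
  Matrix.reindex (blockEquiv h) (blockEquiv h) (Matrix.fromBlocks 1 0 0 g)

theorem blockOne_apply {n N : ℕ} (h : n ≤ N) {R : Type} [CommRing R]
    (g : Matrix (Fin n) (Fin n) (LaurentSeries R)) (x y : Fin (N - n) ⊕ Fin n) :
    blockOne h g (blockEquiv h x) (blockEquiv h y) = Matrix.fromBlocks 1 0 0 g x y := by
  simp [blockOne]

theorem matMap_blockOne {n N : ℕ} (h : n ≤ N) {A B : Type} [CommRing A] [CommRing B]
    (φ : A →+* B) (g : Matrix (Fin n) (Fin n) (LaurentSeries A)) :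
    matMap φ (blockOne h g) = blockOne h (matMap φ g) := by
  ext i j : 1
  obtain ⟨x, rfl⟩ := (blockEquiv h).surjective i
  obtain ⟨y, rfl⟩ := (blockEquiv h).surjective j
  rw [blockOne_apply]
  change seriesMap φ (blockOne h g _ _) = _
  rw [blockOne_apply]
  rcases x with a | b <;> rcases y with c | d
  · simp only [Matrix.fromBlocks_apply₁₁, Matrix.one_apply]
    split_ifs <;> simp
  · simp
  · simp
  · rfl

theorem IsOneAdd.blockOne {n N : ℕ} (h : n ≤ N) {R : Type} [CommRing R]
    {g : Matrix (Fin n) (Fin n) (LaurentSeries R)} (hg : IsOneAdd g) :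
    IsOneAdd (blockOne h g) := by
  intro i j s hs
  obtain ⟨x, rfl⟩ := (blockEquiv h).surjective i
  obtain ⟨y, rfl⟩ := (blockEquiv h).surjective j
  rw [Matrix.sub_apply, blockOne_apply]
  rcases x with a | b <;> rcases y with c | d
  · simp [Matrix.one_apply]
  · simp
  · simp
  · have := hg b d s hs
    simpa [Matrix.sub_apply, Matrix.one_apply] using this

section points

variable {n k : ℕ} {R : Type} [CommRing R]

theorem floor_longest_smul_fundCoweight (hn : 0 < n) (hk : 0 < k) (h : n ≤ k * n)
    (x : Fin (k * n - n) ⊕ Fin n) :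
    ⌊longest ((k : ℚ) • fundCoweight (k * n) n) (blockEquiv h x)⌋ =
      blockExp (Fin (k * n - n)) (Fin n) k x := by
  rw [longest_smul_fundCoweight hn hk, Int.floor_intCast]
  rfl

theorem mul_tCoweight_apply (hn : 0 < n) (hk : 0 < k) (h : n ≤ k * n)
    (M : Matrix (Fin (k * n)) (Fin (k * n)) (LaurentSeries R)) (i : Fin (k * n))
    (y : Fin (k * n - n) ⊕ Fin n) :
    (M * tCoweight R (longest ((k : ℚ) • fundCoweight (k * n) n))) i (blockEquiv h y) =
      M i (blockEquiv h y) * tpow R (blockExp _ _ k y) := by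
  rw [tCoweight, Matrix.mul_diagonal, floor_longest_smul_fundCoweight hn hk]

theorem coeff_conj (hn : 0 < n) (hk : 0 < k) (h : n ≤ k * n)
    (M : Matrix (Fin (k * n)) (Fin (k * n)) (LaurentSeries R))
    (x y : Fin (k * n - n) ⊕ Fin n) (s : ℤ) :
    ((tCoweight R (-longest ((k : ℚ) • fundCoweight (k * n) n)) * M *
      tCoweight R (longest ((k : ℚ) • fundCoweight (k * n) n)))
        (blockEquiv h x) (blockEquiv h y)).coeff s =
      (M (blockEquiv h x) (blockEquiv h y)).coeff (s + blockExp _ _ k y - blockExp _ _ k x) := by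
  rw [mul_tCoweight_apply hn hk, coeff_mul_tpow, tCoweight, Matrix.diagonal_mul, mul_comm,
    coeff_mul_tpow, Pi.neg_apply, longest_smul_fundCoweight hn hk, ← Int.cast_neg,
    Int.floor_intCast, ← sub_eq_add_neg]
  rfl

theorem sum_floor_longest (hn : 0 < n) (hk : 0 < k) (h : n ≤ k * n) :
    ∑ j, ⌊longest ((k : ℚ) • fundCoweight (k * n) n) j⌋ = 0 := by
  rw [← (blockEquiv h).sum_comp]
  simp only [floor_longest_smul_fundCoweight hn hk, blockExp, Fintype.sum_sum_type, Sum.elim_inl, Sum.elim_inr,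
    Finset.sum_const, Finset.card_univ, Fintype.card_fin, nsmul_eq_mul]
  push_cast [Nat.cast_sub h]
  ring

variable {lam : Fin n → ℚ}

theorem nonneg_add_longest (hn : 0 < n) (hdom : IsDominant lam)
    (hlast : lam ⟨n - 1, by omega⟩ = -k) (b : Fin n) : 0 ≤ (k : ℚ) + longest lam b := by
  have := last_le_of_isDominant hn hdom b.rev
  rw [hlast] at this
  rw [longest]
  linarith

theorem sum_longest_tau (hn : 0 < n) (hk : 0 < k) (hlast : lam ⟨n - 1, by omega⟩ = -k)
    (hsum : ∑ j, lam j = 0) (h : n ≤ k * n) : ∑ j, longest (tau (k * n) lam) j = 0 := by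
  rw [← psum_self, psum_longest_tau hn hk hlast hsum h le_rfl, Nat.sub_sub_self h, psum_self,
    Finset.sum_add_distrib, sum_longest, hsum]
  simp [mul_comm]

/-- Let an `i × i` minor use `r` second-block columns. The diagonal factor contributes `t^{kr - i}`
and the minor of `diag(1, g)` has the bound for size `r`. In terms of the partial sums `S` of the
numbers `k + (w₀ λ)_b`, the total is `S r - i`, while `S (i - (kn - n)) - i` is required. -/
theorem minorBound_blockOne (hn : 0 < n) (hk : 0 < k) (hdom : IsDominant lam)
    (hlast : lam ⟨n - 1, by omega⟩ = -k) (hsum : ∑ j, lam j = 0) (h : n ≤ k * n)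
    {g : Matrix (Fin n) (Fin n) (LaurentSeries R)} (hg : MinorBound g (psum (longest lam))) :
    MinorBound (blockOne h g * tCoweight R (longest ((k : ℚ) • fundCoweight (k * n) n)))
      (psum (longest (tau (k * n) lam))) := by
  suffices H : MinorBound (Matrix.of fun x y => tpow R (blockExp _ _ k y) *
      Matrix.fromBlocks (1 : Matrix (Fin (k * n - n)) (Fin (k * n - n)) _) 0 0 g x y)
      (psum (longest (tau (k * n) lam))) by
    have := H.comp (blockEquiv h).symm.toEmbedding
    convert this using 1
    ext i j : 1
    obtain ⟨x, rfl⟩ := (blockEquiv h).surjective i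
    obtain ⟨y, rfl⟩ := (blockEquiv h).surjective j
    rw [mul_tCoweight_apply hn hk, blockOne_apply, mul_comm]
    simp
  intro i f f' hf hf'
  have hdet : ((Matrix.of fun x y => tpow R (blockExp _ _ k y) *
      Matrix.fromBlocks (1 : Matrix (Fin (k * n - n)) (Fin (k * n - n)) _) 0 0 g x y).submatrix
      f f').det = (∏ p, tpow R (blockExp _ _ k (f' p))) *
      ((Matrix.fromBlocks (1 : Matrix (Fin (k * n - n)) (Fin (k * n - n)) _) 0 0 g).submatrix
      f f').det := (Matrix.det_mul_row _ _)
  rw [hdet]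
  refine ((ValGE.prod _ fun p _ => ValGE.tpow _).mul
    (valGE_minor_fromBlocks_one hg i f f' hf hf')).mono ?_
  have hr := rightCount_le hf'
  have hl := le_rightCount_add hf'
  have hi := Fintype.card_le_of_injective f' hf'
  rw [Fintype.card_fin] at hr hl
  rw [Fintype.card_fin, Fintype.card_sum, Fintype.card_fin, Fintype.card_fin] at hi
  rw [← Int.cast_sum, sum_blockExp, psum_longest_tau hn hk hlast hsum h (by omega),
    psum_longest k lam hr]
  -- Here dominance enters: `S` is monotone because `-k` is the smallest coordinate of `λ`.
  have := psum_mono (nonneg_add_longest hn hdom hlast)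
    (show i - (k * n - n) ≤ rightCount f' by omega)
  push_cast
  linarith

/-- Adjoining all first-block rows and columns to a `j × j` minor of `g` multiplies it by a power of
`t`. At size `kn - n + j` the bound for `τ(λ)` is then exactly the bound for `λ` at size `j`,
shifted by the same power. -/
theorem minorBound_of_blockOne (hn : 0 < n) (hk : 0 < k)
    (hlast : lam ⟨n - 1, by omega⟩ = -k) (hsum : ∑ j, lam j = 0) (h : n ≤ k * n)
    {g : Matrix (Fin n) (Fin n) (LaurentSeries R)}
    (hg : MinorBound (blockOne h g * tCoweight R (longest ((k : ℚ) • fundCoweight (k * n) n)))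
      (psum (longest (tau (k * n) lam)))) :
    MinorBound g (psum (longest lam)) := by
  intro j f f' hf hf'
  have hj : j ≤ n := by simpa using Fintype.card_le_of_injective f hf
  let e : Fin (k * n - n) ⊕ Fin j ≃ Fin (k * n - n + j) := finSumFinEquiv
  let F : (Fin j → Fin n) → Fin (k * n - n + j) → Fin (k * n) := fun f p =>
    blockEquiv h (Sum.map id f (e.symm p))
  have hF : ∀ f : Fin j → Fin n, Function.Injective f → Function.Injective (F f) :=
    fun f hf => (blockEquiv h).injective.comp
      ((Function.injective_id.sumMap hf).comp e.symm.injective)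
  have hdet : (((blockOne h g * tCoweight R (longest ((k : ℚ) • fundCoweight (k * n) n))).submatrix
      (F f) (F f')).det) = tpow R (k * j - (k * n - n + j : ℕ)) * (g.submatrix f f').det := by
    have h1 : (blockOne h g * tCoweight R (longest ((k : ℚ) • fundCoweight (k * n) n))).submatrix
        (F f) (F f') = (Matrix.fromBlocks (Matrix.diagonal fun _ => tpow R (-1)) 0 0
        (Matrix.of fun p q => tpow R (k - 1) * g.submatrix f f' p q)).submatrix e.symm e.symm := by
      ext p q : 1
      obtain ⟨x, rfl⟩ := e.surjective p
      obtain ⟨y, rfl⟩ := e.surjective q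
      simp only [Matrix.submatrix_apply, F, Equiv.symm_apply_apply]
      rw [mul_tCoweight_apply hn hk, blockOne_apply]
      rcases x with a | b <;> rcases y with c | d <;>
        simp [blockExp, Matrix.one_apply, Matrix.diagonal_apply, mul_comm]
    rw [h1, Matrix.det_submatrix_equiv_self, Matrix.det_fromBlocks_zero₂₁, Matrix.det_diagonal,
      Matrix.det_mul_row (fun _ => tpow R ((k : ℤ) - 1)) (g.submatrix f f'), ← mul_assoc]
    simp only [Finset.prod_const, Finset.card_univ, Fintype.card_fin, tpow_pow, tpow_mul_tpow]
    congr 2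
    push_cast
    ring
  have H := hg _ _ _ (hF f hf) (hF f' hf')
  rw [hdet] at H
  -- The power of `t` is a unit and is divided out again.
  have H' := (ValGE.tpow (R := R) (-(k * j - (k * n - n + j : ℕ)))).mul H
  rw [← mul_assoc, tpow_mul_tpow, neg_add_cancel, tpow_zero, one_mul,
    psum_longest_tau hn hk hlast hsum h (by omega), Nat.add_sub_cancel_left] at H'
  refine H'.mono ?_
  rw [psum_longest k lam hj]
  push_cast
  linarith

/-- Only the `1 × 1` minors and the conjugation condition are needed: the former fix the first-block
columns, and both together kill the upper right block. -/
theorem eq_blockOne (hn : 0 < n) (hk : 0 < k) (hdom : IsDominant lam)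
    (hlast : lam ⟨n - 1, by omega⟩ = -k) (hsum : ∑ j, lam j = 0) (h : n ≤ k * n)
    {M : Matrix (Fin (k * n)) (Fin (k * n)) (LaurentSeries R)} (hM : IsOneAdd M)
    (hconj : ∀ (i j : Fin (k * n)) (e : ℤ), 0 ≤ e →
      ((tCoweight R (-longest ((k : ℚ) • fundCoweight (k * n) n)) * M *
        tCoweight R (longest ((k : ℚ) • fundCoweight (k * n) n)) - 1) i j).coeff (-e) = 0)
    (hminor : MinorBound (M * tCoweight R (longest ((k : ℚ) • fundCoweight (k * n) n)))
      (psum (longest (tau (k * n) lam)))) :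
    M = blockOne h (M.submatrix (blockEquiv h ∘ Sum.inr) (blockEquiv h ∘ Sum.inr)) := by
  have hentry : ∀ x y, ∀ s : ℤ, blockExp _ _ k y + 1 < s →
      (M (blockEquiv h x) (blockEquiv h y)).coeff s = 0 := by
    intro x y s hs
    have h1 := hminor 1 (fun _ => blockEquiv h x) (fun _ => blockEquiv h y)
      (Function.injective_of_subsingleton _) (Function.injective_of_subsingleton _)
    rw [Matrix.det_fin_one, Matrix.submatrix_apply, mul_tCoweight_apply hn hk] at h1
    -- The number `1 - (kn - n)` is `0` for `k ≥ 2` and `1` for `k = 1`; in both cases the partial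
    -- sum is nonnegative, so every entry of `h` has valuation at least `-1`.
    have hp := psum_mono (nonneg_add_longest hn hdom hlast) (Nat.zero_le (1 - (k * n - n)))
    rw [psum_zero] at hp
    have h2 := h1 (blockExp _ _ k y - s) (by
      rw [psum_longest_tau hn hk hlast hsum h (by nlinarith)]
      have : blockExp _ _ k y - s < -1 := by omega
      have : ((blockExp _ _ k y - s : ℤ) : ℚ) < -1 := by exact_mod_cast this
      push_cast at this ⊢
      linarith)
    rw [coeff_mul_tpow] at h2
    rwa [neg_sub, sub_add_cancel] at h2
  have hleft : ∀ x a, M (blockEquiv h x) (blockEquiv h (Sum.inl a)) =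
      (1 : Matrix _ _ (LaurentSeries R)) (blockEquiv h x) (blockEquiv h (Sum.inl a)) := by
    intro x a
    ext s
    rcases le_or_gt s 0 with hs | hs
    · have := hM (blockEquiv h x) (blockEquiv h (Sum.inl a)) s hs
      rwa [Matrix.sub_apply, HahnSeries.coeff_sub, sub_eq_zero] at this
    · rw [hentry x (Sum.inl a) s (by simpa [blockExp] using hs), Matrix.one_apply]
      split_ifs
      · rw [HahnSeries.coeff_one, if_neg hs.ne']
      · rw [HahnSeries.coeff_zero]
  ext i j : 1
  obtain ⟨x, rfl⟩ := (blockEquiv h).surjective i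
  obtain ⟨y, rfl⟩ := (blockEquiv h).surjective j
  rw [blockOne_apply]
  rcases y with c | d
  · rw [hleft]
    rcases x with a | b <;> simp [Matrix.one_apply]
  · rcases x with a | b
    · ext s
      rw [Matrix.fromBlocks_apply₁₂, Matrix.zero_apply, HahnSeries.coeff_zero]
      -- In this block conjugation multiplies by `t^k`, so the coefficients of `t^{-s}` with `s ≤ k`
      -- vanish; the entry bound handles `s > k`.
      rcases le_or_gt s k with hs | hs
      · have := hconj (blockEquiv h (Sum.inl a)) (blockEquiv h (Sum.inr d)) (k - s) (by omega)
        rw [Matrix.sub_apply, HahnSeries.coeff_sub, coeff_conj hn hk, Matrix.one_apply_ne (by simp),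
          HahnSeries.coeff_zero, sub_zero] at this
        rw [← this]
        congr 1
        simp only [blockExp, Sum.elim_inl, Sum.elim_inr]
        ring
      · exact hentry _ _ _ (by simpa [blockExp] using hs)
    · rfl

theorem det_blockOne {N : ℕ} (h : n ≤ N) (g : Matrix (Fin n) (Fin n) (LaurentSeries R)) :
    (blockOne h g).det = g.det := by
  rw [blockOne, Matrix.det_reindex_self, Matrix.det_fromBlocks_zero₂₁, Matrix.det_one, one_mul]

theorem relations_zero_iff [Algebra ℂ R] (hsum : ∑ j, lam j = 0)
    {g : Matrix (Fin n) (Fin n) (LaurentSeries R)} (hg : IsOneAdd g) :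
    relations 0 lam g ⊆ {0} ↔ g.det = 1 ∧ MinorBound g (psum (longest lam)) := by
  have h0 : longest (0 : Fin n → ℚ) = 0 := rfl
  have h1 : tCoweight R (0 : Fin n → ℚ) = 1 := by
    simp [tCoweight, tpow_zero]
  rw [relations_subset_zero_iff (by simp [h0]) (by rw [sum_longest, hsum]), h0, neg_zero, h1,
    Matrix.one_mul, Matrix.mul_one]
  -- For `μ = 0` the conjugation condition is already contained in `IsOneAdd`.
  exact ⟨fun H => ⟨H.1, H.2.2⟩, fun H => ⟨H.1, fun i j e he => hg i j _ (by omega), H.2⟩⟩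

theorem relations_blockOne_iff [Algebra ℂ R] (hn : 0 < n) (hk : 0 < k) (hdom : IsDominant lam)
    (hlast : lam ⟨n - 1, by omega⟩ = -k) (hsum : ∑ j, lam j = 0) (h : n ≤ k * n)
    {g : Matrix (Fin n) (Fin n) (LaurentSeries R)} (hg : IsOneAdd g) :
    relations ((k : ℚ) • fundCoweight (k * n) n) (tau (k * n) lam) (blockOne h g) ⊆ {0} ↔
      relations 0 lam g ⊆ {0} := by
  rw [relations_subset_zero_iff (sum_floor_longest hn hk h)
    (sum_longest_tau hn hk hlast hsum h), relations_zero_iff hsum hg, det_blockOne]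
  refine ⟨fun H => ⟨H.1, minorBound_of_blockOne hn hk hlast hsum h H.2.2⟩,
    fun H => ⟨H.1, fun i j e he => ?_, minorBound_blockOne hn hk hdom hlast hsum h H.2⟩⟩
  obtain ⟨x, rfl⟩ := (blockEquiv h).surjective i
  obtain ⟨y, rfl⟩ := (blockEquiv h).surjective j
  have h1 := hg.blockOne h (blockEquiv h x) (blockEquiv h y) (-e) (by omega)
  rw [Matrix.sub_apply, HahnSeries.coeff_sub] at h1 ⊢
  rw [coeff_conj hn hk]
  -- Conjugation fixes the entries within a diagonal block, and the entries between different blocks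
  -- are zero.
  by_cases hxy : x.isLeft = y.isLeft
  · rwa [blockExp_congr _ _ k x y hxy, add_sub_cancel_right]
  · rw [blockOne_apply, Matrix.one_apply_ne fun hE => hxy (by rw [(blockEquiv h).injective hE])]
    rcases x with a | b <;> rcases y with c | d <;> simp_all

theorem exists_eq_blockOne [Algebra ℂ R] (hn : 0 < n) (hk : 0 < k)
    (hdom : IsDominant lam) (hlast : lam ⟨n - 1, by omega⟩ = -k) (hsum : ∑ j, lam j = 0)
    (h : n ≤ k * n) {M : Matrix (Fin (k * n)) (Fin (k * n)) (LaurentSeries R)} (hM : IsOneAdd M)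
    (hrel : relations ((k : ℚ) • fundCoweight (k * n) n) (tau (k * n) lam) M ⊆ {0}) :
    ∃ g : Matrix (Fin n) (Fin n) (LaurentSeries R), IsOneAdd g ∧ relations 0 lam g ⊆ {0} ∧
      M = blockOne h g := by
  obtain ⟨-, hconj, hminor⟩ := (relations_subset_zero_iff (sum_floor_longest hn hk h)
    (sum_longest_tau hn hk hlast hsum h)).mp hrel
  have hMg := eq_blockOne hn hk hdom hlast hsum h hM hconj hminor
  have hg : IsOneAdd (M.submatrix (blockEquiv h ∘ Sum.inr) (blockEquiv h ∘ Sum.inr)) := by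
    intro i j s hs
    have := hM (blockEquiv h (Sum.inr i)) (blockEquiv h (Sum.inr j)) s hs
    simpa [Matrix.sub_apply, Matrix.one_apply] using this
  refine ⟨_, hg, ?_, hMg⟩
  rw [hMg] at hrel
  exact (relations_blockOne_iff hn hk hdom hlast hsum h hg).mp hrel

theorem blockOne_injective {N : ℕ} (h : n ≤ N) :
    Function.Injective (blockOne h : Matrix (Fin n) (Fin n) (LaurentSeries R) → _) := by
  intro g g' hgg
  ext i j : 1
  have := congrFun (congrFun hgg (blockEquiv h (Sum.inr i))) (blockEquiv h (Sum.inr j))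
  rwa [blockOne_apply, blockOne_apply] at this

theorem blockMatrix_eq (hn : 0 < n) (hk : 0 < k) (h : n ≤ k * n)
    (g : Matrix (Fin n) (Fin n) (LaurentSeries R)) :
    blockMatrix h k g =
      blockOne h g * tCoweight R (longest ((k : ℚ) • fundCoweight (k * n) n)) := by
  ext i j : 1
  obtain ⟨x, rfl⟩ := (blockEquiv h).surjective i
  obtain ⟨y, rfl⟩ := (blockEquiv h).surjective j
  rw [mul_tCoweight_apply hn hk, blockOne_apply]
  have : blockMatrix h k g (blockEquiv h x) (blockEquiv h y) =
      Matrix.fromBlocks (tpow R (-1) • 1) 0 0 (tpow R ((k : ℤ) - 1) • g) x y := by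
    simp [blockMatrix, blockEquiv]
  rw [this]
  rcases x with a | b <;> rcases y with c | d <;> simp [blockExp, mul_comm, Matrix.one_apply]

end points

/-! ### The isomorphism of slices -/

section iso

variable {n k : ℕ} {lam : Fin n → ℚ}

/-- The coordinate rings of two slices are isomorphic if their points correspond under a natural
injective map of matrices. -/
theorem exists_algEquiv_of_slicePoint {N N' : ℕ} {mu nu : Fin N → ℚ} {mu' nu' : Fin N' → ℚ}
    (F : ∀ {R : Type} [CommRing R], Matrix (Fin N) (Fin N) (LaurentSeries R) →
      Matrix (Fin N') (Fin N') (LaurentSeries R))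
    (hF : ∀ {R : Type} [CommRing R], Function.Injective (F (R := R)))
    (hmap : ∀ {A B : Type} [CommRing A] [CommRing B] (φ : A →+* B) (g),
      matMap φ (F g) = F (matMap φ g))
    (h : IsOneAdd (F (slicePoint mu nu))) (hrel : relations mu' nu' (F (slicePoint mu nu)) ⊆ {0})
    {g : Matrix (Fin N) (Fin N) (LaurentSeries (SliceRing mu' nu'))} (hg : IsOneAdd g)
    (hgrel : relations mu nu g ⊆ {0}) (hgF : slicePoint mu' nu' = F g) :
    ∃ a : SliceRing mu' nu' ≃ₐ[ℂ] SliceRing mu nu,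
      matMap (a : SliceRing mu' nu' →+* SliceRing mu nu) (slicePoint mu' nu') =
        F (slicePoint mu nu) := by
  obtain ⟨θ, hθ⟩ : ∃ θ : SliceRing mu' nu' →ₐ[ℂ] SliceRing mu nu,
      matMap (θ : SliceRing mu' nu' →+* SliceRing mu nu) (slicePoint mu' nu') =
        F (slicePoint mu nu) := ⟨_, matMap_evalSlice _ h hrel⟩
  obtain ⟨ψ, hψ⟩ : ∃ ψ : SliceRing mu nu →ₐ[ℂ] SliceRing mu' nu',
      matMap (ψ : SliceRing mu nu →+* SliceRing mu' nu') (slicePoint mu nu) = g :=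
    ⟨_, matMap_evalSlice g hg hgrel⟩
  -- Both sides have the same image under the injective map `F`, since `F` commutes with change of
  -- coefficients.
  have hθg : matMap (θ : SliceRing mu' nu' →+* SliceRing mu nu) g = slicePoint mu nu := by
    apply hF
    rw [← hmap, ← hgF, hθ]
  have hθψ : θ.comp ψ = AlgHom.id ℂ (SliceRing mu nu) := by
    refine sliceRing_hom_ext ?_
    change matMap (θ : SliceRing mu' nu' →+* SliceRing mu nu)
      (matMap (ψ : SliceRing mu nu →+* SliceRing mu' nu') (slicePoint mu nu)) = slicePoint mu nu
    rw [hψ, hθg]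
  have hψθ : ψ.comp θ = AlgHom.id ℂ (SliceRing mu' nu') := by
    refine sliceRing_hom_ext ?_
    change matMap (ψ : SliceRing mu nu →+* SliceRing mu' nu')
      (matMap (θ : SliceRing mu' nu' →+* SliceRing mu nu) (slicePoint mu' nu')) =
      slicePoint mu' nu'
    rw [hθ, hmap, hψ, ← hgF]
  exact ⟨AlgEquiv.ofAlgHom θ ψ hθψ hψθ, hθ⟩

/-- The coordinate rings of the two slices are isomorphic, through `g ↦ diag(1, g)`. -/
theorem exists_sliceRing_algEquiv (hn : 0 < n) (hk : 0 < k) (hdom : IsDominant lam)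
    (hlast : lam ⟨n - 1, by omega⟩ = -k) (hsum : ∑ j, lam j = 0) (h : n ≤ k * n) :
    ∃ a : SliceRing ((k : ℚ) • fundCoweight (k * n) n) (tau (k * n) lam) ≃ₐ[ℂ]
        SliceRing (0 : Fin n → ℚ) lam,
      matMap (a : SliceRing ((k : ℚ) • fundCoweight (k * n) n) (tau (k * n) lam) →+*
          SliceRing (0 : Fin n → ℚ) lam)
        (slicePoint ((k : ℚ) • fundCoweight (k * n) n) (tau (k * n) lam)) =
        blockOne h (slicePoint 0 lam) := by
  obtain ⟨g, hg, hgrel, hgM⟩ := exists_eq_blockOne hn hk hdom hlast hsum h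
    (isOneAdd_slicePoint ((k : ℚ) • fundCoweight (k * n) n) (tau (k * n) lam))
    (relations_slicePoint _ _)
  exact exists_algEquiv_of_slicePoint (fun g => blockOne h g) (fun H => blockOne_injective h H)
    (fun φ g => matMap_blockOne h φ g) ((isOneAdd_slicePoint 0 lam).blockOne h)
    ((relations_blockOne_iff hn hk hdom hlast hsum h (isOneAdd_slicePoint 0 lam)).mpr
      (relations_slicePoint 0 lam)) hg hgrel hgM

open CategoryTheory AlgebraicGeometry

theorem pointMatrix_eq {N : ℕ} {mu nu : Fin N → ℚ} {R : Type} [CommRing R]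
    (q : Spec (CommRingCat.of R) ⟶ Spec (CommRingCat.of (SliceRing mu nu))) :
    pointMatrix (mu := mu) (lam := nu) q =
      matMap (Spec.preimage q).hom (slicePoint mu nu) * tCoweight R (longest mu) := by
  change matMap ((Spec.preimage q).hom.comp (Ideal.Quotient.mk (sliceIdeal mu nu)))
    (universal N * tCoweight (Ambient N) (longest mu)) = _
  rw [map_mul, matMap_tCoweight]
  rfl

/-- An isomorphism of coordinate rings gives an isomorphism of slices. -/
def sliceIso {N N' : ℕ} {mu nu : Fin N → ℚ} {mu' nu' : Fin N' → ℚ}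
    (a : SliceRing mu' nu' ≃ₐ[ℂ] SliceRing mu nu) : slice mu nu ≅ slice mu' nu' :=
  Over.isoMk (Scheme.Spec.mapIso a.toRingEquiv.toCommRingCatIso.op) <| by
    change Spec.map (CommRingCat.ofHom (a : SliceRing mu' nu' →+* SliceRing mu nu)) ≫
      Spec.map (CommRingCat.ofHom (algebraMap ℂ (SliceRing mu' nu'))) =
      Spec.map (CommRingCat.ofHom (algebraMap ℂ (SliceRing mu nu)))
    rw [← Spec.map_comp, ← CommRingCat.ofHom_comp]
    congr 2
    exact a.toAlgHom.comp_algebraMap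

end iso

/-! ### The last coordinate and the coordinate sum of `λ`, and the theorem -/

theorem last_eq_neg {n : ℕ} (hn : 2 ≤ n) (m : Fin (n - 1) → ℕ) :
    (∑ j, (m j : ℚ) • simpleCoroot n j.rev) ⟨n - 1, by omega⟩ =
      -(m ⟨0, Nat.sub_pos_of_lt hn⟩ : ℚ) := by
  have hA : ∀ j : Fin (n - 1), (⟨n - 1, by omega⟩ : Fin n) ≠ rowA j.rev := fun j hj => by
    have := congrArg Fin.val hj
    have := j.rev.2
    simp only [rowA] at *
    omega
  -- Only the last simple coroot `α_{n-1}` has a nonzero last coordinate, namely `-1`; because of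
  -- the reversed numbering its coefficient is `m_1`.
  rw [Finset.sum_apply, Finset.sum_eq_single ⟨0, Nat.sub_pos_of_lt hn⟩]
  · have hB : (⟨n - 1, by omega⟩ : Fin n) = rowB (Fin.rev ⟨0, Nat.sub_pos_of_lt hn⟩) := by
      ext
      simp only [rowB, Fin.val_rev]
      omega
    rw [Pi.smul_apply, simpleCoroot, Pi.sub_apply, Pi.single_eq_of_ne (hA _), hB,
      Pi.single_eq_same]
    simp
  · intro j _ hj
    have hB : (⟨n - 1, by omega⟩ : Fin n) ≠ rowB j.rev := fun h => hj <| by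
      have := congrArg Fin.val h
      ext
      simp only [rowB, Fin.val_rev] at *
      omega
    rw [Pi.smul_apply, simpleCoroot, Pi.sub_apply, Pi.single_eq_of_ne (hA _),
      Pi.single_eq_of_ne hB]
    simp
  · simp

theorem sum_simpleCoroot_eq_zero {n : ℕ} (m : Fin (n - 1) → ℕ) :
    ∑ i, (∑ j, (m j : ℚ) • simpleCoroot n j.rev) i = 0 := by
  simp only [Finset.sum_apply]
  rw [Finset.sum_comm]
  refine Finset.sum_eq_zero fun j _ => ?_
  simp only [Pi.smul_apply, ← Finset.smul_sum, simpleCoroot, Pi.sub_apply, Finset.sum_sub_distrib]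
  simp

end AffineSlice
end

open CategoryTheory AlgebraicGeometry AffineSlice in
theorem proposition4p4 (n : ℕ) (hn : 2 ≤ n) (m : Fin (n - 1) → ℕ) (lam : Fin n → ℚ)
    (hlam : lam = ∑ j, (m j : ℚ) • simpleCoroot n j.rev) (hdom : IsDominant lam)
    (k : ℕ) (hk : k = m ⟨0, Nat.sub_pos_of_lt hn⟩) (hpos : 0 < k) :
    ∃ e : slice (0 : Fin n → ℚ) lam ≅
        slice ((k : ℚ) • fundCoweight (k * n) n) (tau (k * n) lam),
      ∀ (R : Type) [CommRing R] (p : Spec (CommRingCat.of R) ⟶ (slice (0 : Fin n → ℚ) lam).left),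
        pointMatrix (p ≫ e.hom.left) =
          blockMatrix (Nat.le_mul_of_pos_left n hpos) k (pointMatrix p) := by
  have hn0 : 0 < n := by omega
  have hlast : lam ⟨n - 1, by omega⟩ = -k := by rw [hlam, hk, last_eq_neg hn]
  have hsum : ∑ j, lam j = 0 := by rw [hlam, sum_simpleCoroot_eq_zero]
  have hle := Nat.le_mul_of_pos_left n hpos
  obtain ⟨a, ha⟩ := exists_sliceRing_algEquiv hn0 hpos hdom hlast hsum hle
  refine ⟨sliceIso a, fun R _ p => ?_⟩
  let φ : SliceRing ((k : ℚ) • fundCoweight (k * n) n) (tau (k * n) lam) →+*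
    SliceRing (0 : Fin n → ℚ) lam := a
  let q : Spec (CommRingCat.of R) ⟶ Spec (CommRingCat.of (SliceRing (0 : Fin n → ℚ) lam)) := p
  have h1 := pointMatrix_eq (mu := (k : ℚ) • fundCoweight (k * n) n) (nu := tau (k * n) lam)
    (q ≫ Spec.map (CommRingCat.ofHom φ))
  have h2 : (Spec.preimage (q ≫ Spec.map (CommRingCat.ofHom φ))).hom =
      (Spec.preimage q).hom.comp φ := by
    rw [← CommRingCat.hom_ofHom φ, ← CommRingCat.hom_comp]
    congr 1
    apply Spec.map_injective
    rw [Spec.map_preimage, Spec.map_comp, Spec.map_preimage]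
  -- For `μ = 0` the factor `t^{w₀ μ}` is trivial, so `h` coincides with `g`.
  have h3 : pointMatrix p = matMap (Spec.preimage q).hom (slicePoint 0 lam) := by
    refine (pointMatrix_eq q).trans ?_
    have : tCoweight R (longest (0 : Fin n → ℚ)) = 1 := by
      simp [tCoweight, longest, tpow_zero]
    rw [this, Matrix.mul_one]
  refine h1.trans ?_
  -- The block matrix of the theorem is `diag(1, g) t^{w₀ μ}`, and `diag(1, g)` is the image of the
  -- universal point of the large slice under `a` and then the point `p`.
  rw [h2, h3, blockMatrix_eq hn0 hpos hle, ← matMap_blockOne, ← ha]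
  rfl
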